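/- Let $n\ge 2$. There exist a velocity field $v\in L^\infty(\mathbb{R}^n_x\times\mathbb{R}_t;\mathbb{R}^n)$ and a pressure $p\in L^\infty(\mathbb{R}^n_x\times\mathbb{R}_t)$ that solve the incompressible Euler equations without force, $$\partial_t v+\operatorname{div}(v\otimes v)+\nabla p=0,\qquad \operatorname{div} v=0,$$ in the sense of distributions on $\mathbb{R}^n_x\times\mathbb{R}_t$, that is, $$\int \Big(v_i\,\partial_t\varphi+\sum_{j=1}^n v_iv_j\,\partial_{x_j}\varphi+p\,\partial_{x_i}\varphi\Big)\,dx\,dt=0\quad(i=1,\dots,n),\qquad \int \sum_{i=1}^n v_i\,\partial_{x_i}\varphi\,dx\,dt=0$$ for every $\varphi\in C_c^\infty(\mathbb{R}^n_x\times\mathbb{R}_t)$, such that $v$ is not identically zero (i.e. it is not the case that $v=0$ almost everywhere), and $\operatorname{supp} v$ and $\operatorname{supp} p$ are compact in space-time $\mathbb{R}^n_x\times\mathbb{R}_t$. -/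

import Mathlib

open MeasureTheory
open scoped ContDiff ENNReal

/-- Space-time `ℝⁿ × ℝ`; a point is `(x, t)`, and `volume` is Lebesgue measure. -/
abbrev SpaceTime (n : ℕ) : Type := EuclideanSpace ℝ (Fin n) × ℝ

/-- The spatial partial derivative `∂φ/∂xᵢ` of a function on space-time. -/
noncomputable def spaceDeriv {n : ℕ} (i : Fin n) (φ : SpaceTime n → ℝ) (y : SpaceTime n) : ℝ :=
  fderiv ℝ φ y (EuclideanSpace.single i 1, 0)

/-- The time derivative `∂φ/∂t` of a function on space-time. -/
noncomputable def timeDeriv {n : ℕ} (φ : SpaceTime n → ℝ) (y : SpaceTime n) : ℝ :=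
  fderiv ℝ φ y (0, 1)

/-- A scalar test function: `φ ∈ C_c^∞(ℝⁿ × ℝ)`. -/
def IsTestFunction {n : ℕ} (φ : SpaceTime n → ℝ) : Prop :=
  ContDiff ℝ ∞ φ ∧ HasCompactSupport φ

/-- `(v, p)` solves the Euler equations
`∂ₜ v + div (v ⊗ v) + ∇ p - f = 0`, `div v = 0`
with force `f` on `ℝⁿ × ℝ` in the sense of distributions. The
integrability conditions say that every term defines a distribution; the vector equation is tested
component by component. -/
structure IsDistributionalEulerSolution (n : ℕ)
    (v : SpaceTime n → EuclideanSpace ℝ (Fin n)) (p : SpaceTime n → ℝ)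
    (f : SpaceTime n → EuclideanSpace ℝ (Fin n)) : Prop where
  locallyIntegrable_velocity : LocallyIntegrable v
  locallyIntegrable_tensor : ∀ i j : Fin n, LocallyIntegrable fun y => v y i * v y j
  locallyIntegrable_pressure : LocallyIntegrable p
  locallyIntegrable_force : LocallyIntegrable f
  momentum : ∀ φ : SpaceTime n → ℝ, IsTestFunction φ → ∀ i : Fin n,
    ∫ y, (v y i * timeDeriv φ y + ∑ j : Fin n, v y i * v y j * spaceDeriv j φ y
      + p y * spaceDeriv i φ y + f y i * φ y) = 0
  incompressible : ∀ φ : SpaceTime n → ℝ, IsTestFunction φ →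
    ∫ y, ∑ i : Fin n, v y i * spaceDeriv i φ y = 0

/-
Relax the Euler equations to the linear system `∂ₜ v + div u = 0`, `div v = 0` with `u` symmetric
and trace free, and measure the distance of a state `(v, u)` from the Euler constraint by its defect
`n⁻¹ • 1 - v ⊗ v + u`. A strict subsolution has positive definite defect, of trace `1 - ‖v‖²`; so
when `‖v‖ → 1` the defect tends to zero, and the limit solves the Euler equations with pressure
`-1 / n`.

In dimension at least two there is, at every state, a direction in which the linear system admits
plane waves of arbitrarily high frequency and which changes the defect only in the component along
one of its large eigenvectors. Localized waves of this kind, placed on a disjoint family of small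
balls, turn a fixed proportion of `∫ (1 - ‖v‖²)²` into kinetic energy while being almost orthogonal
in `L²` to any finite set of fields. Iterating, the energies stay bounded, so the sequence is Cauchy
in `L²`, and `‖v‖ = 1` holds in the limit almost everywhere on the chosen open set.
-/

open scoped SchwartzMap LineDeriv RealInnerProductSpace Topology
open Filter Set

section DivergenceFree

variable {V : Type*} [NormedAddCommGroup V] [NormedSpace ℝ V]

theorem lineDerivOp_comm (φ : 𝓢(V, ℝ)) (a b : V) : ∂_{a} (∂_{b} φ) = ∂_{b} (∂_{a} φ) := by
  have h : ∀ (a b y : V), (∂_{a} (∂_{b} φ) : 𝓢(V, ℝ)) y = fderiv ℝ (fderiv ℝ φ) y a b := by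
    intro a b y
    rw [SchwartzMap.lineDerivOp_apply_eq_fderiv]
    have hd : DifferentiableAt ℝ (fderiv ℝ φ) y := (SchwartzMap.fderivCLM ℝ V ℝ φ).differentiableAt
    exact congrArg (· a)
      ((hd.hasFDerivAt.clm_apply (hasFDerivAt_const b y)).fderiv.trans (by simp; rfl))
  ext y
  rw [h, h]
  exact (φ.contDiffAt (n := 2)).isSymmSndFDerivAt (by simp) a b

theorem exists_norm_fderiv_apply_le (φ : 𝓢(V, ℝ)) : ∃ C, ∀ y a, ‖fderiv ℝ φ y a‖ ≤ C * ‖a‖ := by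
  obtain ⟨C, hC⟩ := φ.decay 0 1
  exact ⟨C, fun y a => (fderiv ℝ φ y).le_of_opNorm_le (by simpa using hC.2 y) a⟩

variable [MeasurableSpace V] {μ : Measure V} {W W' : V → V}

theorem aestronglyMeasurable_fderiv_apply [BorelSpace V] [FiniteDimensional ℝ V]
    (hW : AEStronglyMeasurable W μ) (φ : 𝓢(V, ℝ)) :
    AEStronglyMeasurable (fun y => fderiv ℝ φ y (W y)) μ :=
  (ContinuousLinearMap.id ℝ (V →L[ℝ] ℝ)).aestronglyMeasurable_comp₂
    (SchwartzMap.fderivCLM ℝ V ℝ φ).continuous.aestronglyMeasurable hW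

theorem integrable_fderiv_apply [BorelSpace V] [FiniteDimensional ℝ V]
    (hW : Integrable W μ) (φ : 𝓢(V, ℝ)) : Integrable (fun y => fderiv ℝ φ y (W y)) μ := by
  obtain ⟨C, hC⟩ := exists_norm_fderiv_apply_le φ
  exact (hW.norm.const_mul C).mono' (aestronglyMeasurable_fderiv_apply hW.1 φ)
    (.of_forall fun y => hC y (W y))

/-- An integrable vector field whose distributional divergence vanishes. Schwartz functions serve as
test functions. -/
structure IsWeaklyDivFree (μ : Measure V) (W : V → V) : Prop where
  integrable : Integrable W μ
  integral_fderiv_eq_zero : ∀ φ : 𝓢(V, ℝ), ∫ y, fderiv ℝ φ y (W y) ∂μ = 0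

namespace IsWeaklyDivFree

theorem zero : IsWeaklyDivFree μ 0 where
  integrable := integrable_zero _ _ _
  integral_fderiv_eq_zero φ := by simp

theorem const_smul (h : IsWeaklyDivFree μ W) (c : ℝ) : IsWeaklyDivFree μ (c • W) where
  integrable := h.integrable.smul c
  integral_fderiv_eq_zero φ := by
    simp only [Pi.smul_apply, map_smul, integral_smul, h.integral_fderiv_eq_zero, smul_zero]

variable [BorelSpace V] [FiniteDimensional ℝ V]

theorem add (h : IsWeaklyDivFree μ W) (h' : IsWeaklyDivFree μ W') :
    IsWeaklyDivFree μ (W + W') where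
  integrable := h.integrable.add h'.integrable
  integral_fderiv_eq_zero φ := by
    simp only [Pi.add_apply, map_add]
    rw [integral_add (integrable_fderiv_apply h.integrable φ)
      (integrable_fderiv_apply h'.integrable φ), h.integral_fderiv_eq_zero,
      h'.integral_fderiv_eq_zero, add_zero]

theorem of_tendsto {W : ℕ → V → V} {bound : V → ℝ}
    (h : ∀ k, IsWeaklyDivFree μ (W k)) (hbound : Integrable bound μ)
    (hle : ∀ k y, ‖W k y‖ ≤ bound y)
    (hlim : ∀ᵐ y ∂μ, Tendsto (fun k => W k y) atTop (𝓝 (W' y))) : IsWeaklyDivFree μ W' where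
  integrable := by
    refine hbound.mono'
      (aestronglyMeasurable_of_tendsto_ae atTop (fun k => (h k).integrable.1) hlim) ?_
    filter_upwards [hlim] with y hy
    exact le_of_tendsto' hy.norm fun k => hle k y
  integral_fderiv_eq_zero φ := by
    obtain ⟨C, hC⟩ := exists_norm_fderiv_apply_le φ
    have hC₀ : 0 ≤ |C| := abs_nonneg C
    have hconv := tendsto_integral_of_dominated_convergence (fun y => |C| * bound y)
      (fun k => aestronglyMeasurable_fderiv_apply (h k).integrable.1 φ) (hbound.const_mul |C|)
      (fun k => .of_forall fun y => (hC y (W k y)).trans <|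
        mul_le_mul (le_abs_self C) (hle k y) (norm_nonneg _) hC₀)
      (hlim.mono fun y hy => ((fderiv ℝ φ y).continuous.tendsto _).comp hy)
    simp only [(h _).integral_fderiv_eq_zero] at hconv
    exact tendsto_nhds_unique hconv tendsto_const_nhds

end IsWeaklyDivFree

omit [MeasurableSpace V] in
/-- The divergence free field `∂_b ψ a - ∂_a ψ b`, a planar rotated gradient. -/
noncomputable def curlField (ψ : 𝓢(V, ℝ)) (a b : V) (y : V) : V := ∂_{b} ψ y • a - ∂_{a} ψ y • b

theorem isWeaklyDivFree_curlField [BorelSpace V] [FiniteDimensional ℝ V] (μ : Measure V)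
    [μ.IsAddHaarMeasure] (ψ : 𝓢(V, ℝ)) (a b : V) : IsWeaklyDivFree μ (curlField ψ a b) where
  integrable := ((∂_{b} ψ).integrable.smul_const a).sub ((∂_{a} ψ).integrable.smul_const b)
  integral_fderiv_eq_zero φ := by
    have hint (a b : V) : Integrable (fun y => ∂_{b} ψ y * ∂_{a} φ y) μ :=
      (SchwartzMap.pairing (ContinuousLinearMap.mul ℝ ℝ) (∂_{b} ψ) (∂_{a} φ)).integrable
    have hparts (a b : V) : ∫ y, ∂_{b} ψ y * ∂_{a} φ y ∂μ = -∫ y, ∂_{a} (∂_{b} ψ) y * φ y ∂μ :=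
      SchwartzMap.integral_mul_lineDerivOp_right_eq_neg_left _ _ _
    have hpoint (y : V) : fderiv ℝ φ y (curlField ψ a b y)
        = ∂_{b} ψ y * ∂_{a} φ y - ∂_{a} ψ y * ∂_{b} φ y := by
      simp [curlField, SchwartzMap.lineDerivOp_apply_eq_fderiv]
    simp only [hpoint]
    rw [integral_sub (hint a b) (hint b a), hparts, hparts, lineDerivOp_comm, sub_self]

end DivergenceFree

section Oscillation

variable {V F G : Type*} [NormedAddCommGroup V] [NormedSpace ℝ V] [NormedAddCommGroup F]
  [NormedSpace ℝ F] [NormedAddCommGroup G] [NormedSpace ℝ G]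

theorem hasTemperateGrowth_cos : Real.cos.HasTemperateGrowth :=
  ⟨Real.contDiff_cos, fun n => ⟨0, 1, fun x => by
    simpa [norm_iteratedFDeriv_eq_norm_iteratedDeriv] using Real.abs_iteratedDeriv_cos_le_one n x⟩⟩

/-- The modulation `φ cos (N ℓ + θ)` of a Schwartz function by a plane wave. -/
noncomputable def modulate (φ : 𝓢(V, ℝ)) (ℓ : StrongDual ℝ V) (N θ : ℝ) : 𝓢(V, ℝ) :=
  SchwartzMap.smulLeftCLM ℝ (fun y => Real.cos (N * ℓ y + θ)) φ

theorem modulate_apply (φ : 𝓢(V, ℝ)) (ℓ : StrongDual ℝ V) (N θ : ℝ) (y : V) :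
    modulate φ ℓ N θ y = Real.cos (N * ℓ y + θ) * φ y := by
  have hg : (fun y => Real.cos (N * ℓ y + θ)).HasTemperateGrowth :=
    hasTemperateGrowth_cos.comp (by fun_prop)
  exact SchwartzMap.smulLeftCLM_apply_apply hg φ y

theorem norm_modulate_le (φ : 𝓢(V, ℝ)) (ℓ : StrongDual ℝ V) (N θ : ℝ) (y : V) :
    ‖modulate φ ℓ N θ y‖ ≤ ‖φ y‖ := by
  rw [modulate_apply, norm_mul]
  exact mul_le_of_le_one_left (norm_nonneg _) (Real.abs_cos_le_one _)

theorem tsupport_modulate_subset (φ : 𝓢(V, ℝ)) (ℓ : StrongDual ℝ V) (N θ : ℝ) :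
    tsupport (modulate φ ℓ N θ) ⊆ tsupport φ := by
  refine closure_mono fun y hy hφ => hy ?_
  rw [modulate_apply, hφ, mul_zero]

theorem lineDerivOp_modulate (φ : 𝓢(V, ℝ)) (ℓ : StrongDual ℝ V) (N θ : ℝ) (a : V) :
    ∂_{a} (modulate φ ℓ N θ)
      = modulate (∂_{a} φ) ℓ N θ + (N * ℓ a) • modulate φ ℓ N (θ + Real.pi / 2) := by
  ext y
  have hphase : HasFDerivAt (fun y => Real.cos (N * ℓ y + θ))
      (-Real.sin (N * ℓ y + θ) • N • ℓ) y :=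
    ((ℓ.hasFDerivAt.const_mul N).add_const θ).cos
  have hprod := (hphase.mul (φ.hasFDerivAt y)).fderiv
  have hfun : ⇑(modulate φ ℓ N θ) = (fun y => Real.cos (N * ℓ y + θ)) * φ :=
    funext (modulate_apply φ ℓ N θ)
  simp only [SchwartzMap.lineDerivOp_apply_eq_fderiv, add_apply,
    smul_apply, modulate_apply, ← add_assoc, Real.cos_add_pi_div_two, hfun, hprod, smul_eq_mul]
  ring

/-- The families `w N` and `w' N` differ by `o(1)` as `N → ∞`, uniformly in space. -/
def IsUniformlyAsymptotic (w w' : ℝ → V → F) : Prop :=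
  ∀ ε > 0, ∀ᶠ N in atTop, ∀ y, ‖w N y - w' N y‖ ≤ ε

namespace IsUniformlyAsymptotic

omit [NormedAddCommGroup V] [NormedSpace ℝ V]

omit [NormedSpace ℝ F] in
theorem add {v v' w w' : ℝ → V → F} (hv : IsUniformlyAsymptotic v v')
    (hw : IsUniformlyAsymptotic w w') :
    IsUniformlyAsymptotic (fun N y => v N y + w N y) (fun N y => v' N y + w' N y) := by
  intro ε hε
  filter_upwards [hv (ε / 2) (half_pos hε), hw (ε / 2) (half_pos hε)] with N h h' y
  rw [add_sub_add_comm]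
  exact (norm_add_le_of_le (h y) (h' y)).trans_eq (add_halves ε)

theorem clm_apply {w w' : ℝ → V → F} (hw : IsUniformlyAsymptotic w w') (L : F →L[ℝ] G) :
    IsUniformlyAsymptotic (fun N y => L (w N y)) (fun N y => L (w' N y)) := by
  intro ε hε
  filter_upwards [hw (ε / (‖L‖ + 1)) (by positivity)] with N h y
  rw [← map_sub]
  calc ‖L (w N y - w' N y)‖ ≤ (‖L‖ + 1) * (ε / (‖L‖ + 1)) :=
        (L.le_opNorm _).trans (by gcongr; exacts [by linarith, h y])
    _ = ε := by field_simp

theorem smul_const {w w' : ℝ → V → ℝ} (hw : IsUniformlyAsymptotic w w') (z : F) :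
    IsUniformlyAsymptotic (fun N y => w N y • z) (fun N y => w' N y • z) :=
  hw.clm_apply (.toSpanSingleton ℝ z)

theorem inv_smul_of_asymptotic {w w' : ℝ → V → F} (hw : IsUniformlyAsymptotic w w') {C : ℝ}
    (hC : ∀ N y, ‖w' N y‖ ≤ C) : IsUniformlyAsymptotic (fun N y => N⁻¹ • w N y) 0 := by
  intro ε hε
  filter_upwards [hw 1 one_pos, eventually_ge_atTop ((1 + C) / ε), eventually_gt_atTop 0]
    with N h hN hN₀ y
  have hwC : ‖w N y‖ ≤ 1 + C :=
    (norm_le_norm_sub_add (w N y) (w' N y)).trans (add_le_add (h y) (hC N y))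
  rw [Pi.zero_apply, Pi.zero_apply, sub_zero, norm_smul, norm_inv, Real.norm_of_nonneg hN₀.le,
    inv_mul_le_iff₀ hN₀]
  rw [div_le_iff₀ hε] at hN
  linarith

end IsUniformlyAsymptotic

theorem isUniformlyAsymptotic_iteratedLineDerivOp_modulate (φ : 𝓢(V, ℝ)) (ℓ : StrongDual ℝ V)
    (θ : ℝ) {k : ℕ} (m : Fin k → V) :
    IsUniformlyAsymptotic (fun N y => N⁻¹ ^ k * ∂^{m} (modulate φ ℓ N θ) y)
      (fun N y => (∏ i, ℓ (m i)) * modulate φ ℓ N (θ + k * (Real.pi / 2)) y) := by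
  induction k generalizing φ θ with
  | zero => exact fun ε hε => .of_forall fun N y => by simp [hε.le]
  | succ k ih =>
    set a := m (Fin.last k)
    have hlower := (ih (∂_{a} φ) θ (Fin.init m)).inv_smul_of_asymptotic
      (C := ‖∏ i, ℓ (Fin.init m i)‖ * SchwartzMap.seminorm ℝ 0 0 (∂_{a} φ)) fun N y => by
        rw [norm_mul]
        gcongr
        exact (norm_modulate_le _ _ _ _ _).trans (SchwartzMap.norm_le_seminorm ℝ _ y)
    have hmain := (ih φ (θ + Real.pi / 2) (Fin.init m)).clm_apply (ℓ a • .id ℝ ℝ)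
    intro ε hε
    filter_upwards [hlower.add hmain ε hε, eventually_ne_atTop 0] with N hN hN₀ y
    convert hN y using 2
    have hθ : θ + (k + 1 : ℕ) * (Real.pi / 2) = θ + Real.pi / 2 + k * (Real.pi / 2) := by
      push_cast; ring
    have hcancel : N⁻¹ ^ (k + 1) * N = N⁻¹ ^ k := by rw [pow_succ, inv_mul_cancel_right₀ hN₀]
    simp only [LineDeriv.iteratedLineDerivOp_succ_right, lineDerivOp_modulate,
      LineDeriv.iteratedLineDerivOp_add, LineDeriv.iteratedLineDerivOp_smul, add_apply, smul_apply,
      smul_eq_mul, ContinuousLinearMap.id_apply, Pi.zero_apply, Fin.prod_univ_castSucc, Fin.init,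
      hθ]
    linear_combination (ℓ a * ∂^{Fin.init m} (modulate φ ℓ N (θ + Real.pi / 2)) y) * hcancel

end Oscillation

section RiemannLebesgue

variable {V : Type*} [NormedAddCommGroup V] [NormedSpace ℝ V] [MeasurableSpace V] [BorelSpace V]
  [FiniteDimensional ℝ V] {μ : Measure V} [μ.IsAddHaarMeasure] {ℓ : StrongDual ℝ V}

theorem tendsto_integral_mul_cos {f : V → ℝ} (hf : Integrable f μ) (hℓ : ℓ ≠ 0) :
    Tendsto (fun N : ℝ => ∫ y, f y * Real.cos (N * ℓ y) ∂μ) atTop (𝓝 0) := by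
  let freq (N : ℝ) : StrongDual ℝ V := -(N / (2 * Real.pi)) • ℓ
  have hfreq : Tendsto freq atTop (cocompact (StrongDual ℝ V)) := by
    have : ProperSpace (StrongDual ℝ V) := FiniteDimensional.proper ℝ _
    rw [← Metric.cobounded_eq_cocompact, ← tendsto_norm_atTop_iff_cobounded]
    simp only [freq, norm_smul, norm_neg]
    exact (tendsto_norm_atTop_atTop.comp (tendsto_id.atTop_div_const (by positivity)))
      |>.atTop_mul_const (norm_pos_iff.2 hℓ)
  have hre := (Complex.continuous_re.tendsto 0).comp
    ((tendsto_integral_exp_smul_cocompact (fun y => (f y : ℂ)) μ).comp hfreq)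
  refine hre.congr fun N => ?_
  have hint : Integrable (fun y => Real.fourierChar (-freq N y) • (f y : ℂ)) μ := by
    refine (integrable_norm_iff ?_).1 (by simpa using hf.norm)
    exact AEStronglyMeasurable.smul (by fun_prop) hf.ofReal.1
  refine (integral_re hint).symm.trans (integral_congr_ae (.of_forall fun y => ?_))
  have hphase : 2 * Real.pi * -freq N y = N * ℓ y := by
    simp only [freq, smul_apply, smul_eq_mul]
    field_simp
  simp only [RCLike.re_to_complex]
  rw [Circle.smul_def, Real.fourierChar_apply, hphase, smul_eq_mul,
    Complex.re_mul_ofReal, Complex.exp_ofReal_mul_I_re, mul_comm]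

variable {F : Type*} [NormedAddCommGroup F] [InnerProductSpace ℝ F] {φ : 𝓢(V, ℝ)} {e : F}
  {w : ℝ → V → F}

theorem tendsto_integral_inner_of_asymptotic_plane_wave (hℓ : ℓ ≠ 0)
    (hwm : ∀ N, AEStronglyMeasurable (w N) μ)
    (hw : IsUniformlyAsymptotic w fun N y => modulate φ ℓ N 0 y • e) {g : V → F}
    (hg : Integrable g μ) : Tendsto (fun N => ∫ y, ⟪g y, w N y⟫ ∂μ) atTop (𝓝 0) := by
  let m (N : ℝ) (y : V) : F := modulate φ ℓ N 0 y • e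
  have hmc (N) : AEStronglyMeasurable (m N) μ := by fun_prop
  have hmle (N y) : ‖m N y‖ ≤ SchwartzMap.seminorm ℝ 0 0 φ * ‖e‖ := by
    rw [norm_smul]
    gcongr
    exact (norm_modulate_le _ _ _ _ _).trans (SchwartzMap.norm_le_seminorm ℝ _ y)
  have hint {r : V → F} {ε : ℝ} (hr : AEStronglyMeasurable r μ) (hle : ∀ y, ‖r y‖ ≤ ε) :
      Integrable (fun y => ⟪g y, r y⟫) μ :=
    (hg.norm.mul_const ε).mono' (hg.1.inner hr) <| .of_forall fun y =>
      (norm_inner_le_norm _ _).trans (by gcongr; exact hle y)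
  have hmain : Tendsto (fun N => ∫ y, ⟪g y, m N y⟫ ∂μ) atTop (𝓝 0) := by
    have hf : Integrable (fun y => ⟪g y, φ y • e⟫) μ :=
      hint (by fun_prop) fun y => by simpa [m, modulate_apply] using hmle 0 y
    refine (tendsto_integral_mul_cos hf hℓ).congr fun N =>
      integral_congr_ae (.of_forall fun y => ?_)
    simp only [m, inner_smul_right, modulate_apply, add_zero]
    ring
  have herror : Tendsto (fun N => ∫ y, ⟪g y, w N y - m N y⟫ ∂μ) atTop (𝓝 0) := by
    rw [Metric.tendsto_nhds]
    intro ε hε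
    set δ := ε / ((∫ y, ‖g y‖ ∂μ) + 1)
    filter_upwards [hw δ (by positivity)] with N hN
    rw [dist_zero_right]
    calc ‖∫ y, ⟪g y, w N y - m N y⟫ ∂μ‖ ≤ ∫ y, ‖g y‖ * δ ∂μ :=
          norm_integral_le_of_norm_le (hg.norm.mul_const δ) <| .of_forall fun y =>
            (norm_inner_le_norm _ _).trans (by gcongr; exact hN y)
      _ < ((∫ y, ‖g y‖ ∂μ) + 1) * δ := by
          rw [integral_mul_const]; gcongr; linarith
      _ = ε := by simp only [δ]; field_simp
  have hsum := hmain.add herror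
  rw [add_zero] at hsum
  refine hsum.congr' ?_
  filter_upwards [hw 1 one_pos] with N hN
  refine (integral_add (hint (hmc N) (hmle N)) (hint ((hwm N).sub (hmc N)) hN)).symm.trans ?_
  simp only [Pi.sub_apply, ← inner_add_right, add_sub_cancel]

theorem tendsto_integral_modulate_sq (φ : 𝓢(V, ℝ)) (hℓ : ℓ ≠ 0) :
    Tendsto (fun N : ℝ => ∫ y, modulate φ ℓ N 0 y ^ 2 ∂μ) atTop
      (𝓝 (1 / 2 * ∫ y, φ y ^ 2 ∂μ)) := by
  have hsq : Integrable (fun y => φ y ^ 2) μ := (φ.memLp 2 μ).integrable_sq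
  have hosc := ((tendsto_integral_mul_cos hsq hℓ).comp
    (tendsto_id.const_mul_atTop (zero_lt_two (α := ℝ)))).const_mul (1 / 2)
  have hsum := hosc.const_add (1 / 2 * ∫ y, φ y ^ 2 ∂μ)
  rw [mul_zero, add_zero] at hsum
  refine hsum.congr fun N => ?_
  have hint : Integrable (fun y => φ y ^ 2 * Real.cos (2 * N * ℓ y)) μ :=
    hsq.mul_bdd (c := 1) (by fun_prop) (.of_forall fun y => Real.abs_cos_le_one _)
  rw [Function.comp_apply, ← mul_add, id, ← integral_add hsq hint, ← integral_const_mul]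
  refine integral_congr_ae (.of_forall fun y => ?_)
  simp only [modulate_apply, add_zero, mul_assoc 2 N, Real.cos_two_mul]
  ring

theorem eventually_lt_energy_of_asymptotic_plane_wave (hℓ : ℓ ≠ 0) (hw₂ : ∀ N, MemLp (w N) 2 μ)
    (hw : IsUniformlyAsymptotic w fun N y => modulate φ ℓ N 0 y • e) (he : ‖e‖ = 1)
    {δ : ℝ} (hδ : δ < 1 / 2 * ∫ y, φ y ^ 2 ∂μ) : ∀ᶠ N in atTop, δ < ∫ y, ‖w N y‖ ^ 2 ∂μ := by
  obtain ⟨δ', hδδ', hδ'⟩ := exists_between hδ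
  set ε := (δ' - δ) / (2 * (∫ y, ‖φ y‖ ∂μ) + 1) with hε
  have hεpos : 0 < ε := div_pos (sub_pos.2 hδδ') (by positivity)
  filter_upwards [(tendsto_integral_modulate_sq φ hℓ).eventually_const_lt hδ', hw ε hεpos]
    with N hmain hN
  have hlower (y : V) : modulate φ ℓ N 0 y ^ 2 - 2 * ε * ‖φ y‖ ≤ ‖w N y‖ ^ 2 := by
    have hclose : ‖modulate φ ℓ N 0 y‖ ≤ ‖w N y‖ + ε := by
      calc ‖modulate φ ℓ N 0 y‖ = ‖modulate φ ℓ N 0 y • e‖ := by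
            rw [norm_smul, he, mul_one]
        _ ≤ ‖w N y‖ + ε := (norm_le_norm_add_norm_sub _ _).trans (by gcongr; exact hN y)
    have hmod := norm_modulate_le φ ℓ N 0 y
    rw [← sq_abs, ← Real.norm_eq_abs]
    rcases le_total ‖modulate φ ℓ N 0 y‖ ε with h | h <;>
      nlinarith [norm_nonneg (modulate φ ℓ N 0 y), norm_nonneg (w N y)]
  have hsq : Integrable (fun y => modulate φ ℓ N 0 y ^ 2) μ :=
    ((modulate φ ℓ N 0).memLp 2 μ).integrable_sq
  have habs : Integrable (fun y => 2 * ε * ‖φ y‖) μ := φ.integrable.norm.const_mul _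
  have hsmall : 2 * ε * ∫ y, ‖φ y‖ ∂μ ≤ δ' - δ := by
    rw [hε]
    field_simp
    linarith
  calc δ < (∫ y, modulate φ ℓ N 0 y ^ 2 ∂μ) - 2 * ε * ∫ y, ‖φ y‖ ∂μ := by linarith
    _ = ∫ y, (modulate φ ℓ N 0 y ^ 2 - 2 * ε * ‖φ y‖) ∂μ := by
        rw [integral_sub hsq habs, integral_const_mul]
    _ ≤ ∫ y, ‖w N y‖ ^ 2 ∂μ :=
        integral_mono (hsq.sub habs) (hw₂ N).norm.integrable_sq hlower

end RiemannLebesgue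

section Defect

open InnerProductSpace Module

variable {E : Type*} [NormedAddCommGroup E] [InnerProductSpace ℝ E]

theorem isPositive_sub_smul_one_mono {A : E →L[ℝ] E} {b c : ℝ} (hbc : b ≤ c)
    (hA : (A - c • 1).IsPositive) : (A - b • 1).IsPositive := by
  rw [show A - b • 1 = A - c • 1 + (c - b) • 1 by module]
  exact hA.add (ContinuousLinearMap.isPositive_one.smul_of_nonneg (sub_nonneg.2 hbc))

theorem isPositive_sub_smul_one_of_norm_sub_le {A B : E →L[ℝ] E} {c δ : ℝ}
    (hA : (A - c • 1).IsPositive) (hB : B.IsSymmetric) (hAB : ‖B - A‖ ≤ δ) :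
    (B - (c - δ) • 1).IsPositive := by
  refine ⟨hB.sub (.smul (by simp) .one), fun x => ?_⟩
  have hBA : -(δ * ‖x‖ ^ 2) ≤ ⟪(B - A) x, x⟫ := by
    refine neg_le_of_abs_le ((abs_real_inner_le_norm _ _).trans ?_)
    calc ‖(B - A) x‖ * ‖x‖ ≤ δ * ‖x‖ * ‖x‖ := by gcongr; exact (B - A).le_of_opNorm_le hAB x
      _ = δ * ‖x‖ ^ 2 := by ring
  have hAx := hA.inner_nonneg_left x
  change 0 ≤ ⟪(B - (c - δ) • 1) x, x⟫
  simp only [sub_apply, smul_apply, one_apply_eq_self, inner_sub_left, real_inner_smul_left,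
    real_inner_self_eq_norm_sq] at hAx hBA ⊢
  linarith

theorem exists_eq_norm_smul {F : Type*} [NormedAddCommGroup F] [NormedSpace ℝ F] [Nontrivial F]
    (w : F) : ∃ ξ : F, ‖ξ‖ = 1 ∧ w = ‖w‖ • ξ := by
  obtain rfl | hw := eq_or_ne w 0
  · obtain ⟨ξ, hξ⟩ := exists_norm_eq F zero_le_one
    exact ⟨ξ, hξ, by simp⟩
  · exact ⟨‖w‖⁻¹ • w, norm_smul_inv_norm hw, by simp [smul_smul, hw]⟩

/-- A pair `(v, u)` of a velocity and a stress; the Euler equations are the linear system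
`∂ₜ v + div u = 0`, `div v = 0` together with the constraint `defect (v, u) = 0`, the pressure
being constant. -/
abbrev EulerState (E : Type*) [NormedAddCommGroup E] [InnerProductSpace ℝ E] :=
  E × (E →L[ℝ] E)

/-- The defect `n⁻¹ • 1 - v ⊗ v + u` of a state, where `n` is the dimension. Subsolutions are the
states with positive defect. -/
noncomputable def defect (z : EulerState E) : E →L[ℝ] E :=
  (finrank ℝ E : ℝ)⁻¹ • 1 - rankOne ℝ z.1 z.1 + z.2

theorem continuous_defect : Continuous (defect (E := E)) := by
  unfold defect
  simp only [rankOne_def]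
  fun_prop

theorem isSymmetric_defect {z : EulerState E} (hz : z.2.IsSymmetric) : (defect z).IsSymmetric :=
  ((LinearMap.IsSymmetric.smul (by simp) .one).sub (isSymmetric_rankOne_self _)).add hz

/-- The wave direction `(e, β (e ⊗ ξ + ξ ⊗ e))`, along which the defect of a state of velocity
`α e + β ξ` changes only in its `e ⊗ e` component. -/
noncomputable def waveDirection (e ξ : E) (β : ℝ) : EulerState E :=
  (e, β • (rankOne ℝ e ξ + rankOne ℝ ξ e))

theorem defect_add_smul_waveDirection {z : EulerState E} {e ξ : E} {α β : ℝ}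
    (hz : z.1 = α • e + β • ξ) (τ : ℝ) :
    defect (z + τ • waveDirection e ξ β) = defect z - (2 * τ * α + τ ^ 2) • rankOne ℝ e e := by
  simp only [defect, waveDirection, Prod.fst_add, Prod.snd_add, Prod.smul_fst, Prod.smul_snd, hz,
    map_add, map_smul, add_apply, smul_apply]
  module

variable [FiniteDimensional ℝ E]

theorem eq_sum_eigenvalues_smul_rankOne {A : E →L[ℝ] E} (hA : A.IsSymmetric) :
    A = ∑ i, hA.eigenvalues rfl i •
      rankOne ℝ (hA.eigenvectorBasis rfl i) (hA.eigenvectorBasis rfl i) := by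
  set b := hA.eigenvectorBasis rfl
  calc A = A ∘L ∑ i, rankOne ℝ (b i) (b i) := by rw [b.sum_rankOne_eq_id]; rfl
    _ = _ := by
      ext x
      have hb (i) : A (b i) = hA.eigenvalues rfl i • b i := hA.apply_eigenvectorBasis rfl i
      simp [hb, smul_comm _ ⟪_, x⟫]

theorem norm_le_trace_of_isPositive {A : E →L[ℝ] E} (hA : A.IsPositive) :
    ‖A‖ ≤ LinearMap.trace ℝ E A := by
  obtain ⟨m, u, rfl⟩ := ContinuousLinearMap.isPositive_iff_eq_sum_rankOne.1 hA
  refine (norm_sum_le _ _).trans_eq ?_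
  simp [trace_rankOne, sq]

theorem exists_isPositive_sub_smul_rankOne [Nontrivial E] {A : E →L[ℝ] E} (hA : A.IsPositive) :
    ∃ e : E, ‖e‖ = 1 ∧
      (A - (LinearMap.trace ℝ E A / finrank ℝ E) • rankOne ℝ e e).IsPositive := by
  have hS := hA.isSymmetric
  have hn : (0 : ℝ) < finrank ℝ E := by exact_mod_cast finrank_pos
  obtain ⟨i, -, hi⟩ : ∃ i ∈ Finset.univ,
      LinearMap.trace ℝ E A / finrank ℝ E ≤ hS.eigenvalues rfl i := by
    refine Finset.exists_le_of_sum_le ⟨⟨0, finrank_pos⟩, Finset.mem_univ _⟩ (le_of_eq ?_)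
    rw [hS.trace_eq_sum_eigenvalues rfl]
    simp [mul_div_cancel₀ _ hn.ne']
  set b := hS.eigenvectorBasis rfl
  have hsplit : A - (LinearMap.trace ℝ E A / finrank ℝ E) • rankOne ℝ (b i) (b i)
      = (hS.eigenvalues rfl i - LinearMap.trace ℝ E A / finrank ℝ E) • rankOne ℝ (b i) (b i)
        + ∑ j ∈ Finset.univ.erase i, hS.eigenvalues rfl j • rankOne ℝ (b j) (b j) := by
    rw [sub_smul, sub_add_eq_add_sub,
      Finset.add_sum_erase _ (fun j => hS.eigenvalues rfl j • rankOne ℝ (b j) (b j))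
        (Finset.mem_univ i), ← eq_sum_eigenvalues_smul_rankOne hS]
  refine ⟨b i, b.norm_eq_one i, hsplit ▸ ?_⟩
  refine .add ((isPositive_rankOne_self _).smul_of_nonneg (sub_nonneg.2 hi)) ?_
  exact ContinuousLinearMap.isPositive_sum _ fun j _ => (isPositive_rankOne_self _).smul_of_nonneg
    (hA.toLinearMap.nonneg_eigenvalues rfl j)

theorem exists_orthogonal_unit_decomposition (hE : 2 ≤ finrank ℝ E) (v : E) {e : E}
    (he : ‖e‖ = 1) : ∃ (ξ : E) (β : ℝ), ‖ξ‖ = 1 ∧ ⟪e, ξ⟫ = 0 ∧ v = ⟪e, v⟫ • e + β • ξ := by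
  have : Nontrivial (ℝ ∙ e)ᗮ := by
    rw [← finrank_pos_iff (R := ℝ)]
    have := (ℝ ∙ e).finrank_add_finrank_orthogonal
    rw [finrank_span_singleton (norm_ne_zero_iff.1 (he ▸ one_ne_zero))] at this
    omega
  have hv : v - ⟪e, v⟫ • e ∈ (ℝ ∙ e)ᗮ := by
    simp [Submodule.mem_orthogonal_singleton_iff_inner_right, inner_sub_right, inner_smul_right, he]
  obtain ⟨ξ, hξ, hw⟩ := exists_eq_norm_smul (⟨_, hv⟩ : (ℝ ∙ e)ᗮ)
  exact ⟨ξ, _, hξ, Submodule.mem_orthogonal_singleton_iff_inner_right.1 ξ.2,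
    sub_eq_iff_eq_add'.1 (congrArg Subtype.val hw)⟩

theorem trace_defect [Nontrivial E] {z : EulerState E} (hz : LinearMap.trace ℝ E z.2 = 0) :
    LinearMap.trace ℝ E (defect z) = 1 - ‖z.1‖ ^ 2 := by
  have hn : (finrank ℝ E : ℝ) ≠ 0 := by exact_mod_cast finrank_pos.ne'
  simp [defect, hz, trace_rankOne, hn]

theorem exists_waveDirection_isPositive (hE : 2 ≤ finrank ℝ E) {z : EulerState E}
    (hz : (defect z).IsPositive) (htr : LinearMap.trace ℝ E z.2 = 0) :
    ∃ (e ξ : E) (β : ℝ), ‖e‖ = 1 ∧ ‖ξ‖ = 1 ∧ ⟪e, ξ⟫ = 0 ∧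
      ∀ τ : ℝ, |τ| ≤ (1 - ‖z.1‖ ^ 2) / (4 * finrank ℝ E) →
        (defect (z + τ • waveDirection e ξ β) - (1 / 4 : ℝ) • defect z).IsPositive := by
  have : Nontrivial E := finrank_pos_iff (R := ℝ).1 (by omega)
  have hn : (2 : ℝ) ≤ finrank ℝ E := by exact_mod_cast hE
  have htrace := trace_defect htr
  obtain ⟨e, he, hκ⟩ := exists_isPositive_sub_smul_rankOne hz
  obtain ⟨ξ, β, hξ, heξ, hv⟩ := exists_orthogonal_unit_decomposition hE z.1 he
  refine ⟨e, ξ, β, he, hξ, heξ, fun τ hτ => ?_⟩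
  set s := (1 - ‖z.1‖ ^ 2) / (4 * finrank ℝ E) with hs
  have hκs : LinearMap.trace ℝ E (defect z) / finrank ℝ E = 4 * s := by
    rw [htrace, hs]
    field_simp
  have hs1 : s ≤ 1 := by
    rw [hs, div_le_one (by positivity)]
    nlinarith [sq_nonneg ‖z.1‖]
  have hv1 : ‖z.1‖ ≤ 1 := by
    have := hz.toLinearMap.trace_nonneg
    rw [htrace] at this
    exact (sq_le_one_iff₀ (norm_nonneg _)).1 (by linarith)
  have hα : |⟪e, z.1⟫| ≤ 1 := (abs_real_inner_le_norm _ _).trans (by rw [he, one_mul]; exact hv1)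
  have hchange : 2 * τ * ⟪e, z.1⟫ + τ ^ 2 ≤ 3 / 4 * (4 * s) := by
    have hcross : τ * ⟪e, z.1⟫ ≤ s * 1 := (le_abs_self _).trans <| by
      rw [abs_mul]
      exact mul_le_mul hτ hα (abs_nonneg _) ((abs_nonneg _).trans hτ)
    have hsq : τ ^ 2 ≤ s * 1 := by
      rw [← sq_abs, sq]
      exact mul_le_mul hτ (hτ.trans hs1) (abs_nonneg _) ((abs_nonneg _).trans hτ)
    linarith
  have hsplit : defect (z + τ • waveDirection e ξ β) - (1 / 4 : ℝ) • defect z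
      = (3 / 4 : ℝ) • (defect z - (4 * s) • rankOne ℝ e e)
        + (3 / 4 * (4 * s) - (2 * τ * ⟪e, z.1⟫ + τ ^ 2)) • rankOne ℝ e e := by
    rw [defect_add_smul_waveDirection hv]
    module
  rw [hκs] at hκ
  exact hsplit ▸ (hκ.smul_of_nonneg (by norm_num)).add
    ((isPositive_rankOne_self e).smul_of_nonneg (sub_nonneg.2 hchange))

theorem exists_waveDirection_isPositive_of_norm_sub_le (hE : 2 ≤ finrank ℝ E) {z : EulerState E}
    (htr : LinearMap.trace ℝ E z.2 = 0) {c : ℝ} (hc : 0 < c) (hz : (defect z - c • 1).IsPositive) :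
    ∃ (e ξ : E) (β : ℝ), ‖e‖ = 1 ∧ ‖ξ‖ = 1 ∧ ⟪e, ξ⟫ = 0 ∧ ∃ δ > 0, ∀ z' : EulerState E,
      z'.2.IsSymmetric → ∀ τ, |τ| ≤ (1 - ‖z.1‖ ^ 2) / (4 * finrank ℝ E) →
        ‖z' - (z + τ • waveDirection e ξ β)‖ ≤ δ → (defect z' - (c / 8) • 1).IsPositive := by
  have hdefect : (defect z).IsPositive := by simpa using isPositive_sub_smul_one_mono hc.le hz
  obtain ⟨e, ξ, β, he, hξ, heξ, hwave⟩ := exists_waveDirection_isPositive hE hdefect htr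
  refine ⟨e, ξ, β, he, hξ, heξ, ?_⟩
  set s := (1 - ‖z.1‖ ^ 2) / (4 * finrank ℝ E)
  have hsegment : IsCompact ((fun τ : ℝ => z + τ • waveDirection e ξ β) '' Icc (-s) s) :=
    isCompact_Icc.image (by fun_prop)
  have hc8 : 0 < c / 8 := by positivity
  have hunif := hsegment.uniformContinuousAt_of_continuousAt defect
    (fun _ _ => continuous_defect.continuousAt) (Metric.dist_mem_uniformity hc8)
  obtain ⟨δ, hδ, hclose⟩ := Metric.mem_uniformity_dist.1 hunif
  refine ⟨δ / 2, half_pos hδ, fun z' hz' τ hτ hzz' => ?_⟩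
  have hdist : ‖defect z' - defect (z + τ • waveDirection e ξ β)‖ ≤ c / 8 := by
    have h := hclose (a := z + τ • waveDirection e ξ β) (b := z')
      (by rw [dist_comm, dist_eq_norm]; linarith) (mem_image_of_mem _ (abs_le.1 hτ))
    rw [← dist_eq_norm, dist_comm]
    exact h.le
  have hquarter : (defect (z + τ • waveDirection e ξ β) - (c / 4) • 1).IsPositive := by
    rw [show defect (z + τ • waveDirection e ξ β) - (c / 4) • 1
      = (defect (z + τ • waveDirection e ξ β) - (1 / 4 : ℝ) • defect z)
        + (1 / 4 : ℝ) • (defect z - c • 1) by module]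
    exact (hwave τ hτ).add (hz.smul_of_nonneg (by norm_num))
  rw [show c / 8 = c / 4 - c / 8 by ring]
  exact isPositive_sub_smul_one_of_norm_sub_le hquarter (isSymmetric_defect hz') hdist

end Defect

section LinearSystem

open InnerProductSpace

variable {E : Type*} [NormedAddCommGroup E] [InnerProductSpace ℝ E]

/-- The space-time field whose divergence is the `a.1`-component of `∂ₜ v + div u` plus `a.2` times
`div v`. -/
noncomputable def flux (a : E × ℝ) : EulerState E →L[ℝ] E × ℝ :=
  (.apply ℝ E a.1 ∘L .snd ℝ E (E →L[ℝ] E) + a.2 • .fst ℝ E (E →L[ℝ] E)).prod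
    (innerSL ℝ a.1 ∘L .fst ℝ E (E →L[ℝ] E))

theorem flux_apply (a : E × ℝ) (z : EulerState E) :
    flux a z = (z.2 a.1 + a.2 • z.1, ⟪a.1, z.1⟫) := rfl

/-- The third-order potential of the linear system in the plane of `e` and `ξ`: for orthonormal
`e`, `ξ` it maps every scalar function to a solution. -/
noncomputable def potential (e ξ : E) (χ : 𝓢(E × ℝ, ℝ)) (y : E × ℝ) : EulerState E :=
  let A : E × ℝ := (e, 0)
  let B : E × ℝ := (ξ, 0)
  let T : E × ℝ := (0, 1)
  ((∂_{B} (∂_{A} (∂_{A} χ)) y + ∂_{B} (∂_{B} (∂_{B} χ)) y) • e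
      - (∂_{A} (∂_{A} (∂_{A} χ)) y + ∂_{A} (∂_{B} (∂_{B} χ)) y) • ξ,
    (2 * ∂_{A} (∂_{B} (∂_{T} χ)) y) • (rankOne ℝ ξ ξ - rankOne ℝ e e)
      + (∂_{A} (∂_{A} (∂_{T} χ)) y - ∂_{B} (∂_{B} (∂_{T} χ)) y) •
        (rankOne ℝ e ξ + rankOne ℝ ξ e))

theorem flux_potential (e ξ : E) (χ : 𝓢(E × ℝ, ℝ)) (a : E × ℝ) :
    let A : E × ℝ := (e, 0)
    let B : E × ℝ := (ξ, 0)
    let T : E × ℝ := (0, 1)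
    let Δχ := ∂_{A} (∂_{A} χ) + ∂_{B} (∂_{B} χ)
    (fun y => flux a (potential e ξ χ y)) =
      ⟪e, a.1⟫ • (curlField Δχ T B + (-2 : ℝ) • curlField (∂_{A} (∂_{T} χ)) A B)
        + ⟪ξ, a.1⟫ • (curlField Δχ A T + (-2 : ℝ) • curlField (∂_{B} (∂_{T} χ)) A B)
        + a.2 • curlField Δχ A B := by
  intro A B T Δχ
  have h₁ : ∂_{T} (∂_{A} (∂_{A} χ)) = ∂_{A} (∂_{A} (∂_{T} χ)) := by
    rw [lineDerivOp_comm _ T, lineDerivOp_comm _ T]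
  have h₂ : ∂_{T} (∂_{B} (∂_{B} χ)) = ∂_{B} (∂_{B} (∂_{T} χ)) := by
    rw [lineDerivOp_comm _ T, lineDerivOp_comm _ T]
  have h₃ : ∂_{B} (∂_{A} (∂_{T} χ)) = ∂_{A} (∂_{B} (∂_{T} χ)) := lineDerivOp_comm _ _ _
  ext y : 1
  simp only [flux_apply, potential, curlField, Pi.add_apply, Pi.smul_apply, Δχ,
    LineDeriv.lineDerivOp_add, add_apply, h₁, h₂, h₃]
  refine Prod.ext ?_ ?_
  · simp only [A, B, T, Prod.fst_add, Prod.fst_sub, Prod.smul_fst, add_apply, sub_apply, smul_apply,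
      rankOne_apply, smul_zero]
    module
  · simp only [A, B, T, Prod.snd_add, Prod.snd_sub, Prod.smul_snd, inner_sub_right,
      inner_smul_right, real_inner_comm a.1, smul_eq_mul]
    ring

theorem potential_eq_zero_of_notMem_tsupport (e ξ : E) {χ : 𝓢(E × ℝ, ℝ)} {y : E × ℝ}
    (hy : y ∉ tsupport χ) : potential e ξ χ y = 0 := by
  have h (a b c : E × ℝ) : ∂_{a} (∂_{b} (∂_{c} χ)) y = 0 := by
    refine image_eq_zero_of_notMem_tsupport fun hmem => hy ?_
    exact SchwartzMap.tsupport_lineDerivOp_subset _ _ <|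
      SchwartzMap.tsupport_lineDerivOp_subset _ _ <|
        SchwartzMap.tsupport_lineDerivOp_subset _ _ hmem
  simp [potential, h]

theorem continuous_potential (e ξ : E) (χ : 𝓢(E × ℝ, ℝ)) : Continuous (potential e ξ χ) := by
  unfold potential
  fun_prop

/-- The phase `⟪ξ, x⟫ - β t` of a plane wave travelling with velocity `β ξ`. -/
noncomputable def wavePhase (ξ : E) (β : ℝ) : StrongDual ℝ (E × ℝ) :=
  (innerSL ℝ ξ).coprod (-β • .id ℝ ℝ)

theorem wavePhase_apply (ξ : E) (β : ℝ) (y : E × ℝ) : wavePhase ξ β y = ⟪ξ, y.1⟫ - β * y.2 := by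
  simp [wavePhase, sub_eq_add_neg]

theorem wavePhase_ne_zero {ξ : E} (hξ : ‖ξ‖ = 1) (β : ℝ) : wavePhase ξ β ≠ 0 := fun h => by
  have := wavePhase_apply ξ β (ξ, 0)
  simp [h, hξ] at this

/-- The localized oscillation of frequency `N` in the direction `waveDirection e ξ β`. The factor
`N⁻³` and the phase shift compensate for the three derivatives in `potential`. -/
noncomputable def localizedWave (e ξ : E) (β : ℝ) (φ : 𝓢(E × ℝ, ℝ)) (N : ℝ) :
    E × ℝ → EulerState E :=
  potential e ξ (N⁻¹ ^ 3 • modulate φ (wavePhase ξ β) N (-(3 * (Real.pi / 2))))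

theorem isUniformlyAsymptotic_localizedWave {e ξ : E} (hξ : ‖ξ‖ = 1)
    (heξ : ⟪e, ξ⟫ = 0) (β : ℝ) (φ : 𝓢(E × ℝ, ℝ)) :
    IsUniformlyAsymptotic (localizedWave e ξ β φ)
      (fun N y => modulate φ (wavePhase ξ β) N 0 y • waveDirection e ξ β) := by
  set ℓ := wavePhase ξ β
  set χ : ℝ → 𝓢(E × ℝ, ℝ) := fun N => N⁻¹ ^ 3 • modulate φ ℓ N (-(3 * (Real.pi / 2)))
  let A : E × ℝ := (e, 0)
  let B : E × ℝ := (ξ, 0)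
  let T : E × ℝ := (0, 1)
  have hA : ℓ A = 0 := by simp [ℓ, A, wavePhase_apply, real_inner_comm, heξ]
  have hB : ℓ B = 1 := by simp [ℓ, B, wavePhase_apply, hξ]
  have hT : ℓ T = -β := by simp [ℓ, T, wavePhase_apply]
  have h (a b c : E × ℝ) : IsUniformlyAsymptotic (fun N y => ∂_{a} (∂_{b} (∂_{c} (χ N))) y)
      fun N y => ℓ a * ℓ b * ℓ c * modulate φ ℓ N 0 y := by
    convert isUniformlyAsymptotic_iteratedLineDerivOp_modulate φ ℓ (-(3 * (Real.pi / 2)))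
      ![a, b, c] using 3
    · simp [χ, LineDeriv.iteratedLineDerivOp_succ_left, LineDeriv.lineDerivOp_smul, Fin.tail_def]
    · simp [Fin.prod_univ_three]
  have hsum := (((((h B A A).add (h B B B)).smul_const ((e, 0) : EulerState E)).add
    (((h A A A).add (h A B B)).smul_const (-ξ, 0))).add
    ((h A B T).smul_const (0, (2 : ℝ) • (rankOne ℝ ξ ξ - rankOne ℝ e e)))).add
    (((h A A T).smul_const (0, rankOne ℝ e ξ + rankOne ℝ ξ e)).add
      ((h B B T).smul_const (0, -(rankOne ℝ e ξ + rankOne ℝ ξ e))))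
  convert hsum using 3 with N y N y
  · refine Prod.ext ?_ ?_ <;>
      simp only [localizedWave, potential, A, B, T, χ, ℓ, Prod.fst_add, Prod.snd_add,
        Prod.smul_fst, Prod.smul_snd] <;>
      module
  · refine Prod.ext ?_ ?_ <;>
      simp only [waveDirection, hA, hB, hT, Prod.fst_add, Prod.snd_add,
        Prod.smul_fst, Prod.smul_snd] <;>
      module

theorem localizedWave_eq_zero_of_notMem_tsupport (e ξ : E) (β : ℝ) {φ : 𝓢(E × ℝ, ℝ)} (N : ℝ)
    {y : E × ℝ} (hy : y ∉ tsupport φ) : localizedWave e ξ β φ N y = 0 :=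
  potential_eq_zero_of_notMem_tsupport e ξ fun h => hy <|
    tsupport_modulate_subset φ _ N _ (tsupport_smul_subset_right (fun _ => N⁻¹ ^ 3) _ h)

variable [MeasurableSpace E] [BorelSpace E] [FiniteDimensional ℝ E]

instance isAddHaarMeasure_volume_spaceTime : (volume : Measure (E × ℝ)).IsAddHaarMeasure :=
  inferInstanceAs ((volume : Measure E).prod (volume : Measure ℝ)).IsAddHaarMeasure

/-- Continuous solutions of the linear system `∂ₜ v + div u = 0`, `div v = 0` with symmetric and
trace free stress. -/
structure IsLinearSolution (z : E × ℝ → EulerState E) : Prop where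
  continuous : Continuous z
  isSymmetric (y : E × ℝ) : (z y).2.IsSymmetric
  trace_eq_zero (y : E × ℝ) : LinearMap.trace ℝ E (z y).2 = 0
  isWeaklyDivFree_flux (a : E × ℝ) : IsWeaklyDivFree volume fun y => flux a (z y)

namespace IsLinearSolution

variable {z w : E × ℝ → EulerState E}

theorem zero : IsLinearSolution (0 : E × ℝ → EulerState E) where
  continuous := continuous_const
  isSymmetric _ := .zero
  trace_eq_zero _ := map_zero _
  isWeaklyDivFree_flux a := by simpa using! IsWeaklyDivFree.zero

theorem add (hz : IsLinearSolution z) (hw : IsLinearSolution w) : IsLinearSolution (z + w) where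
  continuous := hz.continuous.add hw.continuous
  isSymmetric y := (hz.isSymmetric y).add (hw.isSymmetric y)
  trace_eq_zero y := by simp [hz.trace_eq_zero, hw.trace_eq_zero]
  isWeaklyDivFree_flux a := by
    simpa using! (hz.isWeaklyDivFree_flux a).add (hw.isWeaklyDivFree_flux a)

theorem integrable_velocity (hz : IsLinearSolution z) : Integrable fun y => (z y).1 := by
  simpa [flux_apply] using (hz.isWeaklyDivFree_flux (0, 1)).integrable.fst

end IsLinearSolution

theorem isLinearSolution_potential {e ξ : E} (he : ‖e‖ = 1) (hξ : ‖ξ‖ = 1) (heξ : ⟪e, ξ⟫ = 0)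
    (χ : 𝓢(E × ℝ, ℝ)) : IsLinearSolution (potential e ξ χ) where
  continuous := continuous_potential e ξ χ
  isSymmetric y := by
    have hmixed : (rankOne ℝ e ξ + rankOne ℝ ξ e).IsSymmetric := fun x y => by
      change ⟪⟪ξ, x⟫ • e + ⟪e, x⟫ • ξ, y⟫ = ⟪x, ⟪ξ, y⟫ • e + ⟪e, y⟫ • ξ⟫
      simp only [inner_add_left, inner_add_right, real_inner_smul_left, real_inner_smul_right,
        real_inner_comm x]
      ring
    exact (((isSymmetric_rankOne_self ξ).sub (isSymmetric_rankOne_self e)).smul rfl).add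
      (hmixed.smul rfl)
  trace_eq_zero y := by
    simp [potential, trace_rankOne, he, hξ, heξ, real_inner_comm]
  isWeaklyDivFree_flux a := by
    rw [flux_potential]
    exact (((isWeaklyDivFree_curlField ..).add
        ((isWeaklyDivFree_curlField ..).const_smul _)).const_smul _).add
      (((isWeaklyDivFree_curlField ..).add
        ((isWeaklyDivFree_curlField ..).const_smul _)).const_smul _) |>.add
      ((isWeaklyDivFree_curlField ..).const_smul _)

end LinearSystem

section Subsolution

open Module

variable {E : Type*} [NormedAddCommGroup E] [InnerProductSpace ℝ E] [FiniteDimensional ℝ E]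

theorem norm_sq_add_le_one_of_isPositive [Nontrivial E] {z : EulerState E} {c : ℝ}
    (htr : LinearMap.trace ℝ E z.2 = 0) (hz : (defect z - c • 1).IsPositive) :
    ‖z.1‖ ^ 2 + c * finrank ℝ E ≤ 1 := by
  have h := hz.toLinearMap.trace_nonneg
  have htrace : LinearMap.trace ℝ E (defect z - c • 1 : E →L[ℝ] E)
      = 1 - ‖z.1‖ ^ 2 - c * finrank ℝ E := by
    simp [trace_defect htr]
  linarith

theorem norm_defect_le [Nontrivial E] {z : EulerState E}
    (htr : LinearMap.trace ℝ E z.2 = 0) (hz : (defect z).IsPositive) :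
    ‖defect z‖ ≤ 1 - ‖z.1‖ ^ 2 :=
  (norm_le_trace_of_isPositive hz).trans_eq (trace_defect htr)

variable [MeasurableSpace E] [BorelSpace E]

/-- A strict subsolution in `Ω`: a solution of the linear system that vanishes outside `Ω` and whose
defect is positive definite, uniformly in space-time. -/
structure IsStrictSubsolution (Ω : Set (E × ℝ)) (z : E × ℝ → EulerState E) : Prop
    extends IsLinearSolution z where
  eq_zero_of_notMem (y : E × ℝ) : y ∉ Ω → z y = 0
  exists_isPositive : ∃ c > (0 : ℝ), ∀ y, (defect (z y) - c • 1).IsPositive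

namespace IsStrictSubsolution

variable {Ω : Set (E × ℝ)} {z : E × ℝ → EulerState E}

theorem zero [Nontrivial E] (Ω : Set (E × ℝ)) :
    IsStrictSubsolution Ω (0 : E × ℝ → EulerState E) where
  toIsLinearSolution := .zero
  eq_zero_of_notMem _ _ := rfl
  exists_isPositive := by
    refine ⟨(finrank ℝ E : ℝ)⁻¹, by simpa using! finrank_pos, fun y => ?_⟩
    simp [defect, ContinuousLinearMap.isPositive_zero]

theorem isPositive_defect (hz : IsStrictSubsolution Ω z) (y : E × ℝ) :
    (defect (z y)).IsPositive := by
  obtain ⟨c, hc, hpos⟩ := hz.exists_isPositive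
  simpa using isPositive_sub_smul_one_mono hc.le (hpos y)

theorem norm_velocity_lt_one [Nontrivial E] (hz : IsStrictSubsolution Ω z) (y : E × ℝ) :
    ‖(z y).1‖ < 1 := by
  obtain ⟨c, hc, hpos⟩ := hz.exists_isPositive
  have h := norm_sq_add_le_one_of_isPositive (hz.trace_eq_zero y) (hpos y)
  have hn : (0 : ℝ) < finrank ℝ E := by exact_mod_cast finrank_pos
  exact (sq_lt_one_iff₀ (norm_nonneg _)).1 (by nlinarith [mul_pos hc hn])

theorem hasCompactSupport (hz : IsStrictSubsolution Ω z) (hΩ : Bornology.IsBounded Ω) :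
    HasCompactSupport z :=
  .intro hΩ.isCompact_closure fun y hy => hz.eq_zero_of_notMem y fun h => hy (subset_closure h)

theorem memLp_velocity (hz : IsStrictSubsolution Ω z) (hΩ : Bornology.IsBounded Ω) :
    MemLp (fun y => (z y).1) 2 :=
  (continuous_fst.comp hz.continuous).memLp_of_hasCompactSupport
    ((hz.hasCompactSupport hΩ).comp_left rfl)

end IsStrictSubsolution

end Subsolution

section Perturbation

open Module Metric

theorem integrable_inner_of_hasCompactSupport {F X : Type*} [NormedAddCommGroup F]
    [InnerProductSpace ℝ F] [TopologicalSpace X] [MeasurableSpace X] [OpensMeasurableSpace X]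
    [SecondCountableTopologyEither X F] {μ : Measure X} {g w : X → F} (hg : Integrable g μ)
    (hw : Continuous w) (hwc : HasCompactSupport w) : Integrable (fun y => ⟪g y, w y⟫) μ := by
  obtain ⟨C, hC⟩ := hw.bounded_above_of_compact_support hwc
  refine (hg.norm.mul_const C).mono' (hg.1.inner hw.aestronglyMeasurable) (.of_forall fun y => ?_)
  exact (norm_inner_le_norm _ _).trans (by gcongr; exact hC y)

variable {E : Type*} [NormedAddCommGroup E] [InnerProductSpace ℝ E] [FiniteDimensional ℝ E]
  [MeasurableSpace E] [BorelSpace E]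

/-- The state `z` can be perturbed inside `K` by solutions of the linear system so that the defect
stays above `c` on `K`, the kinetic energy of the perturbation is at least `m`, and the
perturbation is as orthogonal as desired to finitely many given fields. -/
def AdmitsGain (z : E × ℝ → EulerState E) (c : ℝ) (K : Set (E × ℝ)) (m : ℝ) : Prop :=
  ∀ G : Set (E × ℝ → E), G.Finite → (∀ g ∈ G, Integrable g) → ∀ ε > 0,
    ∃ w, IsLinearSolution w ∧ (∀ y ∉ K, w y = 0) ∧
      (∀ y ∈ K, (defect (z y + w y) - c • 1).IsPositive) ∧
      m ≤ ∫ y, ‖(w y).1‖ ^ 2 ∧ ∀ g ∈ G, |∫ y, ⟪g y, (w y).1⟫| ≤ ε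

theorem AdmitsGain.empty (z : E × ℝ → EulerState E) (c : ℝ) : AdmitsGain z c ∅ 0 := by
  intro G _ _ ε hε
  exact ⟨0, .zero, by simp, by simp, by simp, by simp [hε.le]⟩

theorem AdmitsGain.union {z : E × ℝ → EulerState E} {c m₁ m₂ : ℝ} {K₁ K₂ : Set (E × ℝ)}
    (h₁ : AdmitsGain z c K₁ m₁) (h₂ : AdmitsGain z c K₂ m₂) (hK₁ : IsCompact K₁)
    (hK₂ : IsCompact K₂) (hK : Disjoint K₁ K₂) : AdmitsGain z c (K₁ ∪ K₂) (m₁ + m₂) := by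
  intro G hG hGi ε hε
  obtain ⟨w₁, hw₁, hzero₁, hpos₁, henergy₁, horth₁⟩ := h₁ G hG hGi (ε / 2) (half_pos hε)
  obtain ⟨w₂, hw₂, hzero₂, hpos₂, henergy₂, horth₂⟩ := h₂ G hG hGi (ε / 2) (half_pos hε)
  have hor (y) : w₁ y = 0 ∨ w₂ y = 0 := by
    by_cases hy : y ∈ K₁
    · exact .inr (hzero₂ y (hK.notMem_of_mem_left hy))
    · exact .inl (hzero₁ y hy)
  have hv₁ : Continuous fun y => (w₁ y).1 := hw₁.continuous.fst
  have hv₂ : Continuous fun y => (w₂ y).1 := hw₂.continuous.fst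
  have hc₁ : HasCompactSupport fun y => (w₁ y).1 := .intro hK₁ fun y hy => by rw [hzero₁ y hy]; rfl
  have hc₂ : HasCompactSupport fun y => (w₂ y).1 := .intro hK₂ fun y hy => by rw [hzero₂ y hy]; rfl
  refine ⟨w₁ + w₂, hw₁.add hw₂, fun y hy => ?_, fun y hy => ?_, ?_, fun g hg => ?_⟩
  · rw [mem_union, not_or] at hy
    simp [hzero₁ y hy.1, hzero₂ y hy.2]
  · rcases hy with hy | hy
    · simpa [hzero₂ y (hK.notMem_of_mem_left hy)] using hpos₁ y hy
    · simpa [hzero₁ y (hK.notMem_of_mem_right hy)] using hpos₂ y hy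
  · calc m₁ + m₂ ≤ (∫ y, ‖(w₁ y).1‖ ^ 2) + ∫ y, ‖(w₂ y).1‖ ^ 2 := add_le_add henergy₁ henergy₂
      _ = ∫ y, (‖(w₁ y).1‖ ^ 2 + ‖(w₂ y).1‖ ^ 2) :=
        (integral_add ((hv₁.memLp_of_hasCompactSupport hc₁).integrable_norm_pow two_ne_zero)
          ((hv₂.memLp_of_hasCompactSupport hc₂).integrable_norm_pow two_ne_zero)).symm
      _ = ∫ y, ‖((w₁ + w₂) y).1‖ ^ 2 := integral_congr_ae <| .of_forall fun y => by
        rcases hor y with h | h <;> simp [h]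
  · simp only [Pi.add_apply, Prod.fst_add, inner_add_right]
    rw [integral_add (integrable_inner_of_hasCompactSupport (hGi g hg) hv₁ hc₁)
      (integrable_inner_of_hasCompactSupport (hGi g hg) hv₂ hc₂), ← add_halves ε]
    exact (abs_add_le _ _).trans (add_le_add (horth₁ g hg) (horth₂ g hg))

theorem AdmitsGain.biUnion {ι : Type*} {z : E × ℝ → EulerState E} {c : ℝ} {F : Finset ι}
    {K : ι → Set (E × ℝ)} {m : ι → ℝ} (h : ∀ i ∈ F, AdmitsGain z c (K i) (m i))
    (hK : ∀ i ∈ F, IsCompact (K i)) (hdisj : (F : Set ι).PairwiseDisjoint K) :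
    AdmitsGain z c (⋃ i ∈ F, K i) (∑ i ∈ F, m i) := by
  classical
  induction F using Finset.induction with
  | empty => simpa using AdmitsGain.empty z c
  | insert i F hi ih =>
    simp only [Finset.mem_insert, forall_eq_or_imp, Finset.coe_insert] at h hK hdisj
    rw [Finset.sum_insert hi, Finset.set_biUnion_insert]
    refine h.1.union (ih h.2 hK.2 (hdisj.subset (subset_insert _ _))) hK.1
      (F.isCompact_biUnion hK.2) ?_
    refine disjoint_iUnion₂_right.2 fun j hj => ?_
    exact hdisj (mem_insert _ _) (mem_insert_of_mem _ hj) fun hij => hi (hij ▸ hj)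

theorem admitsGain_of_localizedWave {e ξ : E} {β : ℝ} (he : ‖e‖ = 1) (hξ : ‖ξ‖ = 1)
    (heξ : ⟪e, ξ⟫ = 0) {z : E × ℝ → EulerState E} (hz : ∀ y, (z y).2.IsSymmetric)
    {K : Set (E × ℝ)} (hK : IsCompact K) {φ : 𝓢(E × ℝ, ℝ)} (hφ : tsupport φ ⊆ K) {c δ m : ℝ}
    (hδ : 0 < δ) (hstable : ∀ y ∈ K, ∀ z' : EulerState E, z'.2.IsSymmetric → ∀ τ, |τ| ≤ |φ y| →
      ‖z' - (z y + τ • waveDirection e ξ β)‖ ≤ δ → (defect z' - c • 1).IsPositive)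
    (hm : m < 1 / 2 * ∫ y, φ y ^ 2) : AdmitsGain z c K m := by
  intro G hG hGi ε hε
  set w := localizedWave e ξ β φ
  have hw (N) : IsLinearSolution (w N) := isLinearSolution_potential he hξ heξ _
  have hzero (N) (y) (hy : y ∉ K) : w N y = 0 :=
    localizedWave_eq_zero_of_notMem_tsupport e ξ β N fun h => hy (hφ h)
  have hv (N) : Continuous fun y => (w N y).1 := (hw N).continuous.fst
  have hvc (N) : HasCompactSupport fun y => (w N y).1 :=
    .intro hK fun y hy => congrArg Prod.fst (hzero N y hy)
  have hasymp := isUniformlyAsymptotic_localizedWave hξ heξ β φ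
  have hvasymp : IsUniformlyAsymptotic (fun N y => (w N y).1)
      fun N y => modulate φ (wavePhase ξ β) N 0 y • e := hasymp.clm_apply (.fst ℝ E (E →L[ℝ] E))
  have henergy := eventually_lt_energy_of_asymptotic_plane_wave (μ := volume)
    (wavePhase_ne_zero hξ β) (fun N => (hv N).memLp_of_hasCompactSupport (hvc N)) hvasymp he hm
  have horth : ∀ᶠ N in atTop, ∀ g ∈ G, |∫ y, ⟪g y, (w N y).1⟫| ≤ ε := by
    refine (eventually_all_finite hG).2 fun g hg => ?_
    have h := tendsto_integral_inner_of_asymptotic_plane_wave (μ := volume)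
      (wavePhase_ne_zero hξ β) (fun N => (hv N).aestronglyMeasurable) hvasymp (hGi g hg)
    exact h.abs.eventually_le_const (by simpa using hε)
  obtain ⟨N, hclose, hNenergy, hNorth⟩ := ((hasymp δ hδ).and (henergy.and horth)).exists
  refine ⟨w N, hw N, hzero N, fun y hy => ?_, hNenergy.le, hNorth⟩
  refine hstable y hy _ ((hz y).add ((hw N).isSymmetric y)) (modulate φ (wavePhase ξ β) N 0 y)
    (norm_modulate_le φ _ N 0 y) ?_
  rw [add_sub_add_left_eq_sub]
  exact hclose y

end Perturbation

section Covering

open Metric Module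

variable {V : Type*} [NormedAddCommGroup V] [NormedSpace ℝ V] [FiniteDimensional ℝ V]
  [MeasurableSpace V] [BorelSpace V]

theorem measureReal_closedBall_eq_two_pow_mul (μ : Measure V) [μ.IsAddHaarMeasure] (x : V) {r : ℝ}
    (hr : 0 ≤ r) :
    μ.real (closedBall x r) = 2 ^ finrank ℝ V * μ.real (closedBall x (r / 2)) := by
  rw [Measure.addHaar_real_closedBall _ _ hr,
    Measure.addHaar_real_closedBall _ _ (div_nonneg hr zero_le_two), div_pow]
  field_simp

theorem exists_schwartzMap_le_integral_sq (μ : Measure V) [μ.IsAddHaarMeasure] (x : V) {r s : ℝ}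
    (hr : 0 < r) (hs : 0 ≤ s) :
    ∃ φ : 𝓢(V, ℝ), tsupport φ ⊆ closedBall x r ∧ (∀ y, |φ y| ≤ s) ∧
      s ^ 2 * μ.real (closedBall x (r / 2)) ≤ ∫ y, φ y ^ 2 ∂μ := by
  let f : ContDiffBump x := ⟨r / 2, r, half_pos hr, half_lt_self hr⟩
  let φ : 𝓢(V, ℝ) := s • f.hasCompactSupport.toSchwartzMap f.contDiff
  have hφ (y) : φ y = s * f y := rfl
  have hint : Integrable (fun y => φ y ^ 2) μ := by
    simpa using (φ.memLp 2 μ).integrable_sq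
  refine ⟨φ, ?_, fun y => ?_, ?_⟩
  · refine (tsupport_smul_subset_right (fun _ => s) f).trans f.tsupport_eq.subset
  · rw [hφ, abs_mul, abs_of_nonneg hs, abs_of_nonneg f.nonneg]
    exact mul_le_of_le_one_right hs f.le_one
  · calc s ^ 2 * μ.real (closedBall x (r / 2))
        = ∫ y in closedBall x (r / 2), φ y ^ 2 ∂μ := by
          rw [setIntegral_congr_fun (g := fun _ => s ^ 2) measurableSet_closedBall
            (fun y hy => by simp [hφ, f.one_of_mem_closedBall hy]), setIntegral_const,
            smul_eq_mul, mul_comm]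
      _ ≤ ∫ y, φ y ^ 2 ∂μ := setIntegral_le_integral hint (.of_forall fun y => sq_nonneg _)

theorem exists_disjoint_closedBall_lt_sum_setIntegral (μ : Measure V) [SFinite μ]
    {Ω : Set V} (hΩ : IsOpen Ω)
    {P : V → ℝ → Prop} (hP : ∀ x ∈ Ω, ∃ᶠ r in 𝓝[>] 0, P x r) {D : V → ℝ}
    (hD : IntegrableOn D Ω μ) {m : ℝ} (hm : m < ∫ y in Ω, D y ∂μ) :
    ∃ (F : Finset V) (r : V → ℝ), (∀ x ∈ F, P x (r x) ∧ closedBall x (r x) ⊆ Ω) ∧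
      (F : Set V).PairwiseDisjoint (fun x => closedBall x (r x)) ∧
      m < ∑ x ∈ F, ∫ y in closedBall x (r x), D y ∂μ := by
  obtain ⟨t, r, htc, -, hr, hcov, hdisj⟩ := Besicovitch.exists_disjoint_closedBall_covering_ae μ
    (fun x => {r | P x r ∧ closedBall x r ⊆ Ω}) Ω (fun x hx δ hδ => by
      have hsmall : ∀ᶠ r in 𝓝[>] 0, closedBall x r ⊆ Ω :=
        nhdsWithin_le_nhds (eventually_closedBall_subset (hΩ.mem_nhds hx))
      obtain ⟨r, ⟨hPr, hrΩ⟩, hrδ⟩ :=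
        (((hP x hx).and_eventually hsmall).and_eventually (Ioo_mem_nhdsGT hδ)).exists
      exact ⟨r, ⟨hPr, hrΩ⟩, hrδ⟩)
    1 (fun _ _ => one_pos)
  have : Countable t := htc
  have hsub : ⋃ x : t, closedBall (x : V) (r x) ⊆ Ω := iUnion_subset fun x => (hr x x.2).1.2
  have hsum : HasSum (fun x : t => ∫ y in closedBall (x : V) (r x), D y ∂μ)
      (∫ y in Ω, D y ∂μ) := by
    have hae : (⋃ x : t, closedBall (x : V) (r x) : Set V) =ᵐ[μ] Ω := by
      refine hsub.eventuallyLE.antisymm (ae_le_set.2 ?_)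
      rwa [← biUnion_eq_iUnion t fun x _ => closedBall x (r x)]
    rw [← setIntegral_congr_set hae]
    exact hasSum_integral_iUnion (fun x => measurableSet_closedBall)
      (fun x y hxy => hdisj x.2 y.2 (Subtype.coe_ne_coe.2 hxy)) (hD.mono_set hsub)
  obtain ⟨F, hF⟩ := (hsum.eventually_const_lt hm).exists
  refine ⟨F.map (.subtype _), r, fun x hx => ?_, ?_, by rwa [Finset.sum_map]⟩
  · obtain ⟨x, -, rfl⟩ := Finset.mem_map.1 hx
    exact (hr x x.2).1
  · refine hdisj.subset fun x hx => ?_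
    obtain ⟨x, -, rfl⟩ := Finset.mem_map.1 hx
    exact x.2

end Covering

section Gain

open Metric Module

variable {E : Type*} [NormedAddCommGroup E] [InnerProductSpace ℝ E] [FiniteDimensional ℝ E]
  [MeasurableSpace E] [BorelSpace E] {Ω : Set (E × ℝ)} {z : E × ℝ → EulerState E}

/-- The proportion of the squared trace of the defect that a perturbation turns into kinetic energy
in dimension `n`: `16 n²` comes from the admissible amplitude of a wave, `2 ^ (n + 1)` from
localizing it in half of a space-time ball, and the remaining factor `16` absorbs the averaging of
the oscillation and the variation of the subsolution in the ball. -/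
noncomputable def gainConst (n : ℕ) : ℝ := 1 / (256 * (n : ℝ) ^ 2 * 2 ^ (n + 1))

theorem gainConst_pos {n : ℕ} (hn : 0 < n) : 0 < gainConst n := by
  unfold gainConst
  positivity

theorem gainConst_mul_setIntegral_closedBall_lt [Nontrivial E] {D : E × ℝ → ℝ} {T r : ℝ}
    {y₀ : E × ℝ} (hT : 0 < T) (hr : 0 < r) (hD : ∀ y ∈ closedBall y₀ r, |D y| ≤ 2 * T) :
    gainConst (finrank ℝ E) * ∫ y in closedBall y₀ r, D y ^ 2
      < 1 / 2 * ((T / (4 * finrank ℝ E)) ^ 2 * volume.real (closedBall y₀ (r / 2))) := by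
  have hn : (0 : ℝ) < finrank ℝ E := by exact_mod_cast finrank_pos
  have hvol : 0 < volume.real (closedBall y₀ (r / 2)) :=
    ENNReal.toReal_pos (measure_closedBall_pos _ _ (half_pos hr)).ne' measure_closedBall_lt_top.ne
  have hgain : 0 < gainConst (finrank ℝ E) := gainConst_pos finrank_pos
  have hint : ∫ y in closedBall y₀ r, D y ^ 2 ≤ (2 * T) ^ 2 * volume.real (closedBall y₀ r) := by
    refine (Real.le_norm_self _).trans (norm_setIntegral_le_of_norm_le_const
      measure_closedBall_lt_top fun y hy => ?_)
    rw [norm_pow]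
    exact pow_le_pow_left₀ (norm_nonneg _) (hD y hy) 2
  calc gainConst (finrank ℝ E) * ∫ y in closedBall y₀ r, D y ^ 2
      ≤ gainConst (finrank ℝ E) * ((2 * T) ^ 2 * volume.real (closedBall y₀ r)) := by gcongr
    _ = 1 / 4 * ((T / (4 * finrank ℝ E)) ^ 2 * volume.real (closedBall y₀ (r / 2))) := by
        rw [measureReal_closedBall_eq_two_pow_mul _ _ hr.le, finrank_prod, finrank_self, gainConst]
        field_simp
        norm_num
    _ < 1 / 2 * ((T / (4 * finrank ℝ E)) ^ 2 * volume.real (closedBall y₀ (r / 2))) := by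
        gcongr
        norm_num

theorem eventually_admitsGain_closedBall (hE : 2 ≤ finrank ℝ E) (hz : IsLinearSolution z) {c : ℝ}
    (hc : 0 < c) (hpos : ∀ y, (defect (z y) - c • 1).IsPositive) (y₀ : E × ℝ) :
    ∀ᶠ r in 𝓝[>] 0, AdmitsGain z (c / 8) (closedBall y₀ r)
      (gainConst (finrank ℝ E) * ∫ y in closedBall y₀ r, (1 - ‖(z y).1‖ ^ 2) ^ 2) := by
  have : Nontrivial E := finrank_pos_iff (R := ℝ).1 (by omega)
  have hn : (0 : ℝ) < finrank ℝ E := by exact_mod_cast finrank_pos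
  have hgap (y) : 0 < 1 - ‖(z y).1‖ ^ 2 := by
    have := norm_sq_add_le_one_of_isPositive (hz.trace_eq_zero y) (hpos y)
    nlinarith [mul_pos hc hn]
  set T := 1 - ‖(z y₀).1‖ ^ 2
  obtain ⟨e, ξ, β, he, hξ, heξ, δ, hδ, hstable⟩ :=
    exists_waveDirection_isPositive_of_norm_sub_le hE (hz.trace_eq_zero y₀) hc (hpos y₀)
  have hnear : ∀ᶠ y in 𝓝 y₀, ‖z y - z y₀‖ ≤ δ / 2 ∧ 1 - ‖(z y).1‖ ^ 2 ≤ 2 * T := by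
    have hz₀ : Continuous fun y => ‖z y - z y₀‖ := (hz.continuous.sub continuous_const).norm
    have hz₁ : Continuous fun y => 1 - ‖(z y).1‖ ^ 2 :=
      continuous_const.sub (hz.continuous.fst.norm.pow 2)
    exact ((hz₀.tendsto y₀).eventually_le_const (by simpa using hδ)).and
      ((hz₁.tendsto y₀).eventually_le_const (lt_two_mul_self (hgap y₀)))
  filter_upwards [nhdsWithin_le_nhds (eventually_closedBall_subset hnear), self_mem_nhdsWithin]
    with r hball hr
  obtain ⟨φ, hφr, hφs, hφ⟩ := exists_schwartzMap_le_integral_sq volume y₀ (mem_Ioi.1 hr)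
    (s := T / (4 * finrank ℝ E)) (div_nonneg (hgap y₀).le (by positivity))
  refine admitsGain_of_localizedWave (β := β) he hξ heξ hz.isSymmetric
    (isCompact_closedBall _ _) hφr (half_pos hδ)
      (fun y hy z' hz' τ hτ hzz' => hstable z' hz' τ (hτ.trans (hφs y)) ?_) ?_
  · rw [← sub_add_sub_cancel _ (z y + τ • waveDirection e ξ β), add_sub_add_right_eq_sub]
    exact (norm_add_le_of_le hzz' (hball hy).1).trans_eq (add_halves δ)
  · refine (gainConst_mul_setIntegral_closedBall_lt (hgap y₀) hr fun y hy => ?_).trans_le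
      (mul_le_mul_of_nonneg_left hφ one_half_pos.le)
    rw [abs_of_pos (hgap y)]
    exact (hball hy).2

theorem IsStrictSubsolution.exists_gain (hE : 2 ≤ finrank ℝ E) (hΩ : IsOpen Ω)
    (hΩb : Bornology.IsBounded Ω) (hz : IsStrictSubsolution Ω z) {m : ℝ}
    (hm : m < gainConst (finrank ℝ E) * ∫ y in Ω, (1 - ‖(z y).1‖ ^ 2) ^ 2)
    {G : Set (E × ℝ → E)} (hG : G.Finite) (hGi : ∀ g ∈ G, Integrable g) {ε : ℝ} (hε : 0 < ε) :
    ∃ w, IsStrictSubsolution Ω (z + w) ∧ m ≤ ∫ y, ‖(w y).1‖ ^ 2 ∧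
      ∀ g ∈ G, |∫ y, ⟪g y, (w y).1⟫| ≤ ε := by
  obtain ⟨c, hc, hpos⟩ := hz.exists_isPositive
  have hint : IntegrableOn (fun y => gainConst (finrank ℝ E) * (1 - ‖(z y).1‖ ^ 2) ^ 2) Ω := by
    have hcont : Continuous fun y => gainConst (finrank ℝ E) * (1 - ‖(z y).1‖ ^ 2) ^ 2 := by
      have := hz.continuous.fst
      fun_prop
    exact (hcont.continuousOn.integrableOn_compact hΩb.isCompact_closure).mono_set subset_closure
  rw [← integral_const_mul] at hm
  obtain ⟨F, r, hF, hdisj, hFm⟩ := exists_disjoint_closedBall_lt_sum_setIntegral volume hΩ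
    (fun y _ => (eventually_admitsGain_closedBall hE hz.toIsLinearSolution hc hpos y).frequently)
    hint hm
  simp only [integral_const_mul] at hFm
  obtain ⟨w, hw, hzero, hwpos, henergy, horth⟩ := AdmitsGain.biUnion (fun y hy => (hF y hy).1)
    (fun y _ => isCompact_closedBall _ _) hdisj G hG hGi ε hε
  refine ⟨w, ⟨hz.toIsLinearSolution.add hw, fun y hy => ?_, c / 8, by positivity, fun y => ?_⟩,
    hFm.le.trans henergy, horth⟩
  · have hyK : y ∉ ⋃ x ∈ F, closedBall x (r x) := fun h => hy <| by
      obtain ⟨x, hx, hyx⟩ := mem_iUnion₂.1 h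
      exact (hF x hx).2 hyx
    simp [hz.eq_zero_of_notMem y hy, hzero y hyK]
  · by_cases hy : y ∈ ⋃ x ∈ F, closedBall x (r x)
    · exact hwpos y hy
    · rw [Pi.add_apply, hzero y hy, add_zero]
      exact isPositive_sub_smul_one_mono (by linarith) (hpos y)

end Gain

section AlmostOrthogonalIncrements

variable {H : Type*} [NormedAddCommGroup H] [InnerProductSpace ℝ H]

theorem norm_sq_eq_add_inner_sub_add_norm_sub_sq (x y : H) :
    ‖y‖ ^ 2 = ‖x‖ ^ 2 + 2 * ⟪x, y - x⟫ + ‖y - x‖ ^ 2 := by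
  rw [← norm_add_sq_real, add_sub_cancel]

theorem abs_inner_sub_le_of_abs_inner_succ_sub_le {x : ℕ → H}
    (h : ∀ k, ∀ i ≤ k, |⟪x i, x (k + 1) - x k⟫| ≤ (1 / 2) ^ k) {k m : ℕ} (hkm : k ≤ m) :
    |⟪x k, x m - x k⟫| ≤ 2 * ((1 / 2) ^ k - (1 / 2) ^ m) := by
  induction m, hkm using Nat.le_induction with
  | base => simp
  | succ m hkm ih =>
    rw [← sub_add_sub_cancel _ (x m), inner_add_right, pow_succ]
    linarith [abs_add_le ⟪x k, x (m + 1) - x m⟫ ⟪x k, x m - x k⟫, h m k hkm]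

theorem cauchySeq_of_abs_inner_succ_sub_le {x : ℕ → H} {B : ℝ} (hB : ∀ k, ‖x k‖ ≤ B)
    (h : ∀ k, ∀ i ≤ k, |⟪x i, x (k + 1) - x k⟫| ≤ (1 / 2) ^ k) : CauchySeq x := by
  set a : ℕ → ℝ := fun k => ‖x k‖ ^ 2 - 4 * (1 / 2) ^ k with ha
  have hdist {k m : ℕ} (hkm : k ≤ m) : ‖x m - x k‖ ^ 2 ≤ a m - a k := by
    have hinner := neg_le_of_abs_le (abs_inner_sub_le_of_abs_inner_succ_sub_le h hkm)
    simp only [ha]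
    linarith [norm_sq_eq_add_inner_sub_add_norm_sub_sq (x k) (x m)]
  have hmono : Monotone a := fun k m hkm => sub_nonneg.1 ((sq_nonneg _).trans (hdist hkm))
  have hbdd : BddAbove (range a) := by
    refine ⟨B ^ 2, forall_mem_range.2 fun k => (sub_le_self _ (by positivity)).trans ?_⟩
    exact pow_le_pow_left₀ (norm_nonneg _) (hB k) 2
  refine cauchySeq_of_le_tendsto_0' (fun k => √((⨆ k, a k) - a k)) (fun k m hkm => ?_) ?_
  · rw [dist_comm, dist_eq_norm]
    exact Real.le_sqrt_of_sq_le ((hdist hkm).trans (sub_le_sub_right (le_ciSup hbdd m) _))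
  · simpa using ((tendsto_atTop_ciSup hmono hbdd).const_sub (⨆ k, a k)).sqrt

theorem exists_seq_abs_inner_succ_sub_le {ι : Type*} [Nonempty ι] {f : ι → H} {D : H → ℝ}
    (h : ∀ (i : ι) (G : Finset ι), ∀ ε > 0, ∃ j, D (f i) - ε ≤ ‖f j - f i‖ ^ 2 ∧
      ∀ g ∈ G, |⟪f g, f j - f i⟫| ≤ ε) :
    ∃ s : ℕ → ι, (∀ k, D (f (s k)) - (1 / 2) ^ k ≤ ‖f (s (k + 1)) - f (s k)‖ ^ 2) ∧
      ∀ k, ∀ i ≤ k, |⟪f (s i), f (s (k + 1)) - f (s k)⟫| ≤ (1 / 2) ^ k := by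
  classical
  choose next hgain horth using fun i G (k : ℕ) => h i G ((1 / 2) ^ k) (by positivity)
  let step (k : ℕ) (p : ι × Finset ι) : ι × Finset ι :=
    (next p.1 p.2 k, insert (next p.1 p.2 k) p.2)
  let p (k : ℕ) : ι × Finset ι :=
    k.rec (Classical.arbitrary ι, {Classical.arbitrary ι}) step
  have hmem {i k : ℕ} (hik : i ≤ k) : (p i).1 ∈ (p k).2 := by
    induction k, hik using Nat.le_induction with
    | base => cases i <;> simp [p, step]
    | succ k _ ih => exact Finset.mem_insert_of_mem ih
  exact ⟨fun k => (p k).1, fun k => hgain _ _ k, fun k i hik => horth _ _ k _ (hmem hik)⟩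

theorem exists_seq_tendsto_nonpos_of_exists_gain [CompleteSpace H] {ι : Type*} [Nonempty ι]
    {f : ι → H} {B : ℝ} (hB : ∀ i, ‖f i‖ ≤ B) {D : H → ℝ} (hD : Continuous D)
    (h : ∀ (i : ι) (G : Finset ι), ∀ ε > 0, ∃ j, D (f i) - ε ≤ ‖f j - f i‖ ^ 2 ∧
      ∀ g ∈ G, |⟪f g, f j - f i⟫| ≤ ε) :
    ∃ (s : ℕ → ι) (X : H), Tendsto (fun k => f (s k)) atTop (𝓝 X) ∧ D X ≤ 0 := by
  obtain ⟨s, hgain, horth⟩ := exists_seq_abs_inner_succ_sub_le h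
  obtain ⟨X, hX⟩ := cauchySeq_tendsto_of_complete
    (cauchySeq_of_abs_inner_succ_sub_le (fun k => hB (s k)) horth)
  refine ⟨s, X, hX, ?_⟩
  have hleft : Tendsto (fun k => D (f (s k)) - (1 / 2) ^ k) atTop (𝓝 (D X - 0)) :=
    ((hD.tendsto X).comp hX).sub
      (tendsto_pow_atTop_nhds_zero_of_lt_one (by norm_num) (by norm_num))
  have hright : Tendsto (fun k => ‖f (s (k + 1)) - f (s k)‖ ^ 2) atTop (𝓝 (‖X - X‖ ^ 2)) :=
    (((tendsto_add_atTop_iff_nat 1).2 hX).sub hX).norm.pow 2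
  simpa using le_of_tendsto_of_tendsto' hleft hright hgain

end AlmostOrthogonalIncrements

section Approximation

open Module

theorem inner_toLp_eq_integral {X F : Type*} [MeasurableSpace X] {μ : Measure X}
    [NormedAddCommGroup F] [InnerProductSpace ℝ F] {f g : X → F} (hf : MemLp f 2 μ)
    (hg : MemLp g 2 μ) : ⟪hf.toLp, hg.toLp⟫ = ∫ y, ⟪f y, g y⟫ ∂μ := by
  rw [L2.inner_def]
  refine integral_congr_ae ?_
  filter_upwards [hf.coeFn_toLp, hg.coeFn_toLp] with y hfy hgy
  rw [hfy, hgy]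

theorem norm_toLp_sq_eq_integral {X F : Type*} [MeasurableSpace X] {μ : Measure X}
    [NormedAddCommGroup F] [InnerProductSpace ℝ F] {f : X → F} (hf : MemLp f 2 μ) :
    ‖hf.toLp‖ ^ 2 = ∫ y, ‖f y‖ ^ 2 ∂μ := by
  simp only [← real_inner_self_eq_norm_sq, inner_toLp_eq_integral]

variable {E : Type*} [NormedAddCommGroup E] [InnerProductSpace ℝ E] [FiniteDimensional ℝ E]
  [MeasurableSpace E] [BorelSpace E] {Ω : Set (E × ℝ)}

/-- The velocity of a strict subsolution in a bounded set, as an element of `L²`. -/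
noncomputable def velocityLp (hΩb : Bornology.IsBounded Ω) (z : {z // IsStrictSubsolution Ω z}) :
    Lp E 2 (volume : Measure (E × ℝ)) :=
  (z.2.memLp_velocity hΩb).toLp

theorem norm_velocityLp_sq (hΩb : Bornology.IsBounded Ω) (z : {z // IsStrictSubsolution Ω z}) :
    ‖velocityLp hΩb z‖ ^ 2 = ∫ y in Ω, ‖(z.1 y).1‖ ^ 2 := by
  rw [velocityLp, norm_toLp_sq_eq_integral, setIntegral_eq_integral_of_forall_compl_eq_zero]
  exact fun y hy => by simp [z.2.eq_zero_of_notMem y hy]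

theorem norm_velocityLp_le [Nontrivial E] (hΩb : Bornology.IsBounded Ω)
    (z : {z // IsStrictSubsolution Ω z}) : ‖velocityLp hΩb z‖ ≤ √(volume.real Ω) := by
  refine Real.le_sqrt_of_sq_le (norm_velocityLp_sq hΩb z ▸ (Real.le_norm_self _).trans ?_)
  refine (norm_setIntegral_le_of_norm_le_const hΩb.measure_lt_top fun y _ => ?_).trans_eq
    (one_mul _)
  rw [norm_pow, norm_norm]
  exact pow_le_one₀ (norm_nonneg _) (z.2.norm_velocity_lt_one y).le

theorem volume_mul_sq_le_setIntegral (hΩb : Bornology.IsBounded Ω) (hΩ₀ : volume Ω ≠ 0)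
    (z : {z // IsStrictSubsolution Ω z}) :
    volume.real Ω * (1 - ‖velocityLp hΩb z‖ ^ 2 / volume.real Ω) ^ 2
      ≤ ∫ y in Ω, (1 - ‖(z.1 y).1‖ ^ 2) ^ 2 := by
  have hvol : 0 < volume.real Ω := ENNReal.toReal_pos hΩ₀ hΩb.measure_lt_top.ne
  have hv : Continuous fun y => (z.1 y).1 := z.2.continuous.fst
  have hint {f : E × ℝ → ℝ} (hf : Continuous f) : IntegrableOn f Ω :=
    (hf.continuousOn.integrableOn_compact hΩb.isCompact_closure).mono_set subset_closure
  have havg : ⨍ y in Ω, (1 - ‖(z.1 y).1‖ ^ 2)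
      = 1 - ‖velocityLp hΩb z‖ ^ 2 / volume.real Ω := by
    rw [setAverage_eq, integral_sub (hint continuous_const)
      (hint (f := fun y => ‖(z.1 y).1‖ ^ 2) (hv.norm.pow 2)), setIntegral_const,
      norm_velocityLp_sq, smul_eq_mul, smul_eq_mul, mul_one]
    field_simp
  have hjensen : (⨍ y in Ω, (1 - ‖(z.1 y).1‖ ^ 2)) ^ 2 ≤ ⨍ y in Ω, (1 - ‖(z.1 y).1‖ ^ 2) ^ 2 :=
    (even_two.convexOn_pow (𝕜 := ℝ)).map_set_average_le (by fun_prop) isClosed_univ hΩ₀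
      hΩb.measure_lt_top.ne (by simp) (hint (by fun_prop)) (hint (by fun_prop))
  rw [havg, setAverage_eq, smul_eq_mul] at hjensen
  rwa [← le_inv_mul_iff₀ hvol]

theorem exists_velocityLp_gain (hE : 2 ≤ finrank ℝ E) (hΩ : IsOpen Ω)
    (hΩb : Bornology.IsBounded Ω) (hΩ₀ : volume Ω ≠ 0) (z : {z // IsStrictSubsolution Ω z})
    (G : Finset {z // IsStrictSubsolution Ω z}) {ε : ℝ} (hε : 0 < ε) :
    ∃ z' : {z // IsStrictSubsolution Ω z},
      gainConst (finrank ℝ E) *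
          (volume.real Ω * (1 - ‖velocityLp hΩb z‖ ^ 2 / volume.real Ω) ^ 2) - ε
        ≤ ‖velocityLp hΩb z' - velocityLp hΩb z‖ ^ 2 ∧
      ∀ g ∈ G, |⟪velocityLp hΩb g, velocityLp hΩb z' - velocityLp hΩb z⟫| ≤ ε := by
  have hgain : 0 < gainConst (finrank ℝ E) := gainConst_pos (zero_lt_two.trans_le hE)
  obtain ⟨w, hw, henergy, horth⟩ := z.2.exists_gain hE hΩ hΩb
    ((sub_lt_self _ hε).trans_le (mul_le_mul_of_nonneg_left
      (volume_mul_sq_le_setIntegral hΩb hΩ₀ z) hgain.le))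
    (G.finite_toSet.image fun g y => (g.1 y).1)
    (forall_mem_image.2 fun g _ => g.2.integrable_velocity) hε
  have hincrement : velocityLp hΩb ⟨_, hw⟩ - velocityLp hΩb z
      = ((hw.memLp_velocity hΩb).sub (z.2.memLp_velocity hΩb)).toLp := rfl
  have hsub (y) : ((z.1 + w) y).1 - (z.1 y).1 = (w y).1 := add_sub_cancel_left _ _
  refine ⟨⟨_, hw⟩, ?_, fun g hg => ?_⟩
  · simpa only [hincrement, norm_toLp_sq_eq_integral, Pi.sub_apply, hsub] using henergy
  · rw [hincrement, velocityLp, inner_toLp_eq_integral]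
    simpa only [Pi.sub_apply, hsub] using horth _ (mem_image_of_mem _ hg)

theorem exists_seq_tendsto_velocityLp (hE : 2 ≤ finrank ℝ E) (hΩ : IsOpen Ω)
    (hΩb : Bornology.IsBounded Ω) (hΩ₀ : volume Ω ≠ 0) :
    ∃ (z : ℕ → {z // IsStrictSubsolution Ω z}) (X : Lp E 2 (volume : Measure (E × ℝ))),
      Tendsto (fun k => velocityLp hΩb (z k)) atTop (𝓝 X) ∧ ‖X‖ ^ 2 = volume.real Ω := by
  have : Nontrivial E := finrank_pos_iff (R := ℝ).1 (by omega)
  have : Nonempty {z // IsStrictSubsolution Ω z} := ⟨⟨0, .zero Ω⟩⟩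
  have hvol : 0 < volume.real Ω := ENNReal.toReal_pos hΩ₀ hΩb.measure_lt_top.ne
  obtain ⟨z, X, hX, hle⟩ := exists_seq_tendsto_nonpos_of_exists_gain (norm_velocityLp_le hΩb)
    (D := fun x => gainConst (finrank ℝ E) * (volume.real Ω * (1 - ‖x‖ ^ 2 / volume.real Ω) ^ 2))
    (by fun_prop) fun z G _ hε => exists_velocityLp_gain hE hΩ hΩb hΩ₀ z G hε
  refine ⟨z, X, hX, ?_⟩
  have hsq : (1 - ‖X‖ ^ 2 / volume.real Ω) ^ 2 ≤ 0 :=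
    nonpos_of_mul_nonpos_right (nonpos_of_mul_nonpos_right hle (gainConst_pos finrank_pos)) hvol
  have hdiv : 1 = ‖X‖ ^ 2 / volume.real Ω := sub_eq_zero.1 (sq_nonpos_iff _ |>.1 hsq)
  exact (div_eq_one_iff_eq hvol.ne').1 hdiv.symm

end Approximation

section Limit

open InnerProductSpace Module

theorem ae_norm_eq_one_of_norm_sq_eq {X F : Type*} [MeasurableSpace X] {μ : Measure X}
    [NormedAddCommGroup F] [InnerProductSpace ℝ F] {s : Set X} (hs : MeasurableSet s)
    (hμs : μ s ≠ ⊤) {f : Lp F 2 μ} (hf₀ : ∀ᵐ y ∂μ, y ∉ s → f y = 0)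
    (hf₁ : ∀ᵐ y ∂μ, ‖f y‖ ≤ 1) (hnorm : ‖f‖ ^ 2 = μ.real s) : ∀ᵐ y ∂μ, y ∈ s → ‖f y‖ = 1 := by
  have hle : (fun y => ‖f y‖ ^ 2) ≤ᵐ[μ] s.indicator 1 := by
    filter_upwards [hf₀, hf₁] with y hy₀ hy₁
    by_cases hy : y ∈ s
    · simpa [hy] using hy₁
    · simp [hy, hy₀ hy]
  have hint : ∫ y, ‖f y‖ ^ 2 ∂μ = ∫ y, s.indicator 1 y ∂μ := by
    rw [← norm_toLp_sq_eq_integral (Lp.memLp f), Lp.toLp_coeFn, hnorm, integral_indicator_one hs]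
  have heq : (fun y => ‖f y‖ ^ 2) =ᵐ[μ] s.indicator 1 :=
    (integral_eq_iff_of_ae_le ((Lp.memLp f).integrable_norm_pow two_ne_zero)
      ((integrable_indicator_iff hs).2 (integrableOn_const hμs)) hle).1 hint
  filter_upwards [heq] with y hy hys
  rw [indicator_of_mem hys, Pi.one_apply] at hy
  exact (pow_eq_one_iff_of_nonneg (norm_nonneg _) two_ne_zero).1 hy

variable {E : Type*} [NormedAddCommGroup E] [InnerProductSpace ℝ E]

theorem snd_eq_defect_sub (z : EulerState E) :
    z.2 = defect z - (finrank ℝ E : ℝ)⁻¹ • 1 + rankOne ℝ z.1 z.1 := by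
  rw [defect]
  abel

variable [FiniteDimensional ℝ E]

theorem norm_le_three_of_isPositive_defect [Nontrivial E] {z : EulerState E}
    (htr : LinearMap.trace ℝ E z.2 = 0) (hz : (defect z).IsPositive) : ‖z‖ ≤ 3 := by
  have hdefect := norm_defect_le htr hz
  have hsq : ‖z.1‖ ^ 2 ≤ 1 := by linarith [norm_nonneg (defect z)]
  have hinv : (finrank ℝ E : ℝ)⁻¹ ≤ 1 := inv_le_one_of_one_le₀ (by exact_mod_cast finrank_pos)
  refine max_le (((sq_le_one_iff₀ (norm_nonneg _)).1 hsq).trans (by norm_num)) ?_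
  calc ‖z.2‖ = ‖defect z - (finrank ℝ E : ℝ)⁻¹ • 1 + rankOne ℝ z.1 z.1‖ :=
        congrArg _ (snd_eq_defect_sub z)
    _ ≤ ‖defect z‖ + (finrank ℝ E : ℝ)⁻¹ + ‖z.1‖ ^ 2 := by
      refine (norm_add_le _ _).trans (add_le_add ((norm_sub_le _ _).trans ?_) ?_)
      · simp [norm_smul]
      · simp [sq]
    _ ≤ 3 := by linarith

theorem tendsto_of_norm_velocity_eq_one [Nontrivial E] {ι : Type*} {l : Filter ι}
    {z : ι → EulerState E} {v : E} (htr : ∀ k, LinearMap.trace ℝ E (z k).2 = 0)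
    (hz : ∀ k, (defect (z k)).IsPositive) (hv : Tendsto (fun k => (z k).1) l (𝓝 v))
    (hunit : ‖v‖ = 1) :
    Tendsto z l (𝓝 (v, rankOne ℝ v v + (-(finrank ℝ E : ℝ)⁻¹) • 1)) := by
  have hdefect : Tendsto (fun k => defect (z k)) l (𝓝 0) := by
    refine squeeze_zero_norm (fun k => norm_defect_le (htr k) (hz k)) ?_
    simpa [hunit] using (hv.norm.pow 2).const_sub 1
  have hrank : Continuous fun x : E => rankOne ℝ x x := by
    simp only [rankOne_def]
    fun_prop
  refine hv.prodMk_nhds ?_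
  rw [show rankOne ℝ v v + (-(finrank ℝ E : ℝ)⁻¹) • 1
    = (0 - (finrank ℝ E : ℝ)⁻¹ • 1 + rankOne ℝ v v : E →L[ℝ] E) by module]
  exact ((hdefect.sub_const _).add ((hrank.tendsto v).comp hv)).congr
    fun k => (snd_eq_defect_sub (z k)).symm

variable [MeasurableSpace E] [BorelSpace E] {Ω : Set (E × ℝ)}

theorem exists_seq_isStrictSubsolution_tendsto_ae (hE : 2 ≤ finrank ℝ E) (hΩ : IsOpen Ω)
    (hΩb : Bornology.IsBounded Ω) (hΩ₀ : volume Ω ≠ 0) :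
    ∃ (z : ℕ → E × ℝ → EulerState E) (v : E × ℝ → E), (∀ k, IsStrictSubsolution Ω (z k)) ∧
      AEStronglyMeasurable v ∧ (∀ y ∉ Ω, v y = 0) ∧
      (∀ᵐ y, Tendsto (fun k => (z k y).1) atTop (𝓝 (v y))) ∧ ∀ᵐ y, y ∈ Ω → ‖v y‖ = 1 := by
  have : Nontrivial E := finrank_pos_iff (R := ℝ).1 (by omega)
  obtain ⟨z, X, hzX, hX⟩ := exists_seq_tendsto_velocityLp hE hΩ hΩb hΩ₀
  obtain ⟨s, -, hs⟩ := (tendstoInMeasure_of_tendsto_Lp hzX).exists_seq_tendsto_ae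
  have hlim : ∀ᵐ y, Tendsto (fun k => ((z (s k)).1 y).1) atTop (𝓝 (X y)) := by
    filter_upwards [hs, ae_all_iff.2 fun k => ((z k).2.memLp_velocity hΩb).coeFn_toLp]
      with y hy hzy
    simpa only [velocityLp, hzy] using hy
  have hX₀ : ∀ᵐ y, y ∉ Ω → X y = 0 := hlim.mono fun y hy hyΩ => by
    simpa only [(z _).2.eq_zero_of_notMem y hyΩ, Prod.fst_zero, tendsto_const_nhds_iff,
      eq_comm] using hy
  have hX₁ : ∀ᵐ y, ‖X y‖ ≤ 1 := hlim.mono fun y hy =>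
    le_of_tendsto' hy.norm fun k => ((z _).2.norm_velocity_lt_one y).le
  refine ⟨fun k => z (s k), Ω.indicator X, fun k => (z _).2,
    (Lp.aestronglyMeasurable X).indicator hΩ.measurableSet,
    fun y hy => indicator_of_notMem hy _, ?_, ?_⟩
  · filter_upwards [hlim, hX₀] with y hy hy₀
    rwa [indicator_apply_eq_self.2 hy₀]
  · filter_upwards [ae_norm_eq_one_of_norm_sq_eq hΩ.measurableSet hΩb.measure_lt_top.ne hX₀ hX₁ hX]
      with y hy hyΩ
    rw [indicator_of_mem hyΩ, hy hyΩ]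

/-- A weak solution of the Euler equations with velocity `v` and pressure `p`: every component of
the space-time flux of `(v, v ⊗ v + p)` is weakly divergence free. -/
def IsWeakEulerSolution (v : E × ℝ → E) (p : E × ℝ → ℝ) : Prop :=
  ∀ a : E × ℝ, IsWeaklyDivFree volume fun y => flux a (v y, rankOne ℝ (v y) (v y) + p y • 1)

theorem exists_isWeakEulerSolution (hE : 2 ≤ finrank ℝ E) (hΩ : IsOpen Ω)
    (hΩb : Bornology.IsBounded Ω) (hΩ₀ : volume Ω ≠ 0) :
    ∃ v : E × ℝ → E, AEStronglyMeasurable v ∧ (∀ y ∉ Ω, v y = 0) ∧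
      (∀ᵐ y, y ∈ Ω → ‖v y‖ = 1) ∧
      IsWeakEulerSolution v (Ω.indicator fun _ => -(finrank ℝ E : ℝ)⁻¹) := by
  have : Nontrivial E := finrank_pos_iff (R := ℝ).1 (by omega)
  obtain ⟨z, v, hz, hvm, hv₀, hlim, hunit⟩ :=
    exists_seq_isStrictSubsolution_tendsto_ae hE hΩ hΩb hΩ₀
  have hstate : ∀ᵐ y, Tendsto (fun k => z k y) atTop (𝓝 (v y, rankOne ℝ (v y) (v y)
      + Ω.indicator (fun _ => -(finrank ℝ E : ℝ)⁻¹) y • 1)) := by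
    filter_upwards [hlim, hunit] with y hy hyunit
    by_cases hyΩ : y ∈ Ω
    · rw [indicator_of_mem hyΩ]
      exact tendsto_of_norm_velocity_eq_one (fun k => (hz k).trace_eq_zero y)
        (fun k => (hz k).isPositive_defect y) hy (hyunit hyΩ)
    · simp [(hz _).eq_zero_of_notMem y hyΩ, hv₀ y hyΩ, indicator_of_notMem hyΩ, ← Prod.zero_eq_mk]
  refine ⟨v, hvm, hv₀, hunit, fun a => ?_⟩
  refine .of_tendsto (bound := Ω.indicator fun _ => ‖flux (E := E) a‖ * 3)
    (fun k => (hz k).isWeaklyDivFree_flux a) ?_ (fun k y => ?_)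
    (hstate.mono fun y hy => ((flux a).continuous.tendsto _).comp hy)
  · exact (integrable_indicator_iff hΩ.measurableSet).2
      (integrableOn_const hΩb.measure_lt_top.ne)
  · by_cases hyΩ : y ∈ Ω
    · rw [indicator_of_mem hyΩ]
      exact (flux a).le_opNorm_of_le (norm_le_three_of_isPositive_defect
        ((hz k).trace_eq_zero y) ((hz k).isPositive_defect y))
    · simp [(hz k).eq_zero_of_notMem y hyΩ, indicator_of_notMem hyΩ]

end Limit

section SpaceTime

open InnerProductSpace Module

variable {n : ℕ}

theorem fderiv_apply_eq_sum (φ : SpaceTime n → ℝ) (y w : SpaceTime n) :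
    fderiv ℝ φ y w = ∑ j, w.1 j * spaceDeriv j φ y + w.2 * timeDeriv φ y := by
  have hw : w = ∑ j, w.1 j • (EuclideanSpace.single j (1 : ℝ), (0 : ℝ)) + w.2 • (0, 1) := by
    have hsum := (EuclideanSpace.basisFun (Fin n) ℝ).sum_repr w.1
    simp only [EuclideanSpace.basisFun_repr, EuclideanSpace.basisFun_apply] at hsum
    ext1
    · simp [Prod.fst_sum, hsum]
    · simp [Prod.snd_sum]
  conv_lhs => rw [hw]
  simp only [map_add, map_sum, map_smul, smul_eq_mul, spaceDeriv, timeDeriv]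

variable {v : SpaceTime n → EuclideanSpace ℝ (Fin n)} {p : SpaceTime n → ℝ}

theorem IsWeakEulerSolution.integral_fderiv_eq_zero (h : IsWeakEulerSolution v p)
    {φ : SpaceTime n → ℝ} (hφ : IsTestFunction φ) (a : SpaceTime n) :
    ∫ y, fderiv ℝ φ y (flux a (v y, rankOne ℝ (v y) (v y) + p y • 1)) = 0 :=
  (h a).integral_fderiv_eq_zero (hφ.2.toSchwartzMap hφ.1)

theorem IsWeakEulerSolution.isDistributionalEulerSolution (h : IsWeakEulerSolution v p)
    (hv : MemLp v ∞) (hp : MemLp p ∞) : IsDistributionalEulerSolution n v p 0 where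
  locallyIntegrable_velocity := hv.locallyIntegrable le_top
  locallyIntegrable_tensor i j := by
    have hcoord (i) : MemLp (fun y => v y i) ∞ :=
      (EuclideanSpace.proj (𝕜 := ℝ) i).comp_memLp' hv
    exact ((hcoord j).mul (hcoord i) (r := ∞)).locallyIntegrable le_top
  locallyIntegrable_pressure := hp.locallyIntegrable le_top
  locallyIntegrable_force := locallyIntegrable_zero
  momentum φ hφ i := by
    rw [← h.integral_fderiv_eq_zero hφ (EuclideanSpace.single i 1, 0)]
    have hflux (y : SpaceTime n) :
        flux (EuclideanSpace.single i 1, 0) (v y, rankOne ℝ (v y) (v y) + p y • 1)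
          = (v y i • v y + p y • EuclideanSpace.single i 1, v y i) := by
      simp [flux_apply, EuclideanSpace.inner_single_left, EuclideanSpace.inner_single_right]
    refine integral_congr_ae (.of_forall fun y => ?_)
    simp only [hflux, fderiv_apply_eq_sum, PiLp.add_apply, PiLp.smul_apply, PiLp.single_apply,
      smul_eq_mul, add_mul, mul_ite, ite_mul, mul_one, mul_zero, zero_mul, Finset.sum_add_distrib,
      Finset.sum_ite_eq', Finset.mem_univ, if_true, Pi.zero_apply, PiLp.zero_apply]
    ring
  incompressible φ hφ := by
    simpa [flux_apply, fderiv_apply_eq_sum] using h.integral_fderiv_eq_zero hφ (0, 1)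

end SpaceTime

theorem theorem1 (n : ℕ) (hn : 2 ≤ n) :
    ∃ (v : SpaceTime n → EuclideanSpace ℝ (Fin n)) (p : SpaceTime n → ℝ),
      MemLp v ∞ volume ∧ MemLp p ∞ volume ∧
      IsDistributionalEulerSolution n v p 0 ∧
      ¬ (v =ᵐ[volume] 0) ∧
      HasCompactSupport v ∧ HasCompactSupport p := by
  set B := Metric.ball (0 : SpaceTime n) 1
  have hB₀ : volume B ≠ 0 := (Metric.measure_ball_pos volume _ one_pos).ne'
  obtain ⟨v, hvm, hv₀, hunit, heuler⟩ :=
    exists_isWeakEulerSolution (by simpa using hn) Metric.isOpen_ball Metric.isBounded_ball hB₀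
  have hv : MemLp v ∞ := memLp_top_of_bound hvm 1 <| hunit.mono fun y hy => by
    by_cases hyB : y ∈ B
    · exact (hy hyB).le
    · simp [hv₀ y hyB]
  have hp : MemLp (B.indicator fun _ => -(Module.finrank ℝ (EuclideanSpace ℝ (Fin n)) : ℝ)⁻¹) ∞ :=
    (memLp_top_const _).indicator Metric.isOpen_ball.measurableSet
  have hsupp {F : Type} [Zero F] {g : SpaceTime n → F} (hg : ∀ y ∉ B, g y = 0) :
      HasCompactSupport g :=
    .intro (isCompact_closedBall 0 1) fun y hy => hg y fun h => hy (Metric.ball_subset_closedBall h)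
  refine ⟨v, _, hv, hp, heuler.isDistributionalEulerSolution hv hp, fun hzero => hB₀ ?_,
    hsupp hv₀, hsupp fun y hy => indicator_of_notMem hy _⟩
  refine measure_eq_zero_iff_ae_notMem.2 ?_
  filter_upwards [hzero, hunit] with y hy hyunit hyB
  simpa [hy] using hyunit hyB
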